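/- Let $\mathbb{D}=\{z\in\mathbb{C}:|z|<1\}$ and let $\mathcal{A}$ be the class of functions $f(z)=z+\sum_{n\ge1}a_{n+1}z^{n+1}$ that are analytic and univalent in $\mathbb{D}$. For $\kappa\ne0,-1,-2,\dots$ and $c\in\mathbb{C}$ put $$B_{\kappa,c}(f)(z)=z+\sum_{n\ge1}a_{n+1}\frac{(-c/4)^n}{(\kappa)_n}\frac{z^{n+1}}{n!},\qquad (\kappa)_n=\kappa(\kappa+1)\cdots(\kappa+n-1),$$ and for $p+\frac{b+1}{2}\ne0,-1,-2,\dots$ put $$u_{p,b,c}(z)=\sum_{n\ge0}\frac{(-c/4)^n}{\left(p+\frac{b+1}{2}\right)_n}\frac{z^n}{n!}.$$ The quotient $B_{\kappa,c}(f)(z)/z$ is given its limit $1$ at $z=0$. For $F,G$ analytic in $\mathbb{D}$ write $F\prec G$ if there is an analytic $w:\mathbb{D}\to\mathbb{C}$ with $|w(z)|\le|z|$ and $F(z)=G(w(z))$ for all $z\in\mathbb{D}$. For $\varphi:\mathbb{C}^2\to\mathbb{C}$ and $h$ univalent in $\mathbb{D}$, a dominant of the differential subordination $\varphi(s(z),zs'(z))\prec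 h(z)$ is a univalent function $q$ on $\mathbb{D}$ with $s\prec q$ for every analytic $s$ on $\mathbb{D}$ satisfying it, and the best dominant is a dominant $\tilde q$ with $\tilde q\prec q$ for every dominant $q$. Let $c\in\mathbb{C}$ with $c\ne0$ and let $p,b\in\mathbb{R}$ be such that $\kappa=p+\frac{b+1}{2}>-1$. (i) Let $g\in\mathcal{A}$ and $\Psi(z)=B_{\kappa+1,c}(g)(z)/z$. Suppose that for all $z\in\mathbb{D}$ we have $\Psi'(z)\ne0$ and $$\operatorname{Re}\left(\frac{z\Psi''(z)}{\Psi'(z)}+1\right)>-\frac{1+(\kappa+1)^2-\sqrt{1+(\kappa+1)^4}}{4(\kappa+1)}.$$ Then for every $f\in\mathcal{A}$, $$\frac{B_{\kappa+1,c}(f)(z)}{z}\prec\frac{B_{\kappa+1,c}(g)(z)}{z}\quad\text{implies}\quad\frac{B_{\kappa+2,c}(f)(z)}{z}\prec\frac{B_{\kappa+2,c}(g)(z)}{z}.$$ Moreover, $\Psi$ is univalent in $\mathbb{D}$, and the function $z\mapsto B_{\kappa+2,c}(g)(z)/z$ is the best dominant of the differential subordination $$s(z)+\frac{zs'(z)}{\kappa+1}\prec\Psi(z).$$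 (For $s(z)=B_{\kappa+2,c}(f)(z)/z$ the left-hand side is $B_{\kappa+1,c}(f)(z)/z$.) (ii) Let $a\in\mathbb{C}$ with $|a|<\frac12$. Then $$u_{p+1,b,c}(z)\prec1-\frac{acz}{4(\kappa+1)}\quad\text{implies}\quad u_{p+2,b,c}(z)\prec1-\frac{acz}{4(\kappa+2)},$$ and likewise, if $|u_{p+1,b,c}(z)-1|<\left|\frac{ac}{4(\kappa+1)}\right|$ for all $z\in\mathbb{D}$, then $|u_{p+2,b,c}(z)-1|<\left|\frac{ac}{4(\kappa+2)}\right|$ for all $z\in\mathbb{D}$. (iii) Let $a\in\mathbb{C}$ with $|a|<\frac12$. If $|\cos\sqrt z-1|<\frac{|a|}{2}$ for all $z\in\mathbb{D}$, then $\left|\frac{\sin\sqrt z}{\sqrt z}-1\right|<\frac{|a|}{6}$ for all $z\in\mathbb{D}\setminus\{0\}$. If the latter holds, then $\left|3\frac{\sin\sqrt z}{z\sqrt z}-3\frac{\cos\sqrt z}{z}-1\right|<\frac{|a|}{10}$ for all $z\in\mathbb{D}\setminus\{0\}$. -/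

import Mathlib

open Complex

noncomputable section

namespace BesselSubordination

/-- The open unit disk of the complex plane. -/
def disk : Set ℂ := Metric.ball (0 : ℂ) 1

/-- `q` is analytic and injective in the open unit disk. -/
def Univalent (q : ℂ → ℂ) : Prop :=
  DifferentiableOn ℂ q disk ∧ Set.InjOn q disk

/-- Normalized univalent functions `f(z) = z + a₂ z² + a₃ z³ + …` in the open unit disk. -/
def ClassA (f : ℂ → ℂ) : Prop :=
  Univalent f ∧ f 0 = 0 ∧ deriv f 0 = 1

/-- `f ≺ F` in the unit disk: `f = F ∘ w` for an analytic `w` with `|w(z)| ≤ |z|`. -/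
def Subordinate (f F : ℂ → ℂ) : Prop :=
  ∃ w : ℂ → ℂ, DifferentiableOn ℂ w disk ∧ (∀ z ∈ disk, ‖w z‖ ≤ ‖z‖) ∧
    ∀ z ∈ disk, f z = F (w z)

/-- The `n`-th Taylor coefficient of `f` at the origin. -/
def taylorCoeff (f : ℂ → ℂ) (n : ℕ) : ℂ :=
  iteratedDeriv n f 0 / (n.factorial : ℂ)

/-- The Pochhammer symbol `(a)_n = a (a + 1) ⋯ (a + n - 1)`. -/
def pochhammer (a : ℂ) (n : ℕ) : ℂ := (ascPochhammer ℂ n).eval a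

/-- The normalized generalized Bessel function
`u_{p,b,c}(z) = ∑ (-c/4)^n / (p + (b+1)/2)_n · z^n / n!`. -/
def besselU (p b c z : ℂ) : ℂ :=
  ∑' n : ℕ, (-c / 4) ^ n / pochhammer (p + (b + 1) / 2) n * (z ^ n / (n.factorial : ℂ))

/-- The convolution operator
`B_{κ,c}(f)(z) = ∑_{n ≥ 0} a_{n+1} (-c/4)^n / (κ)_n · z^{n+1} / n!`,
with `a_n` the Taylor coefficients of `f` (so that `a_1 = 1` for a normalized `f`). -/
def besselB (κ c : ℂ) (f : ℂ → ℂ) (z : ℂ) : ℂ :=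
  ∑' n : ℕ, taylorCoeff f (n + 1) * ((-c / 4) ^ n / pochhammer κ n) *
    (z ^ (n + 1) / (n.factorial : ℂ))

/-- The function `z ↦ B_{κ,c}(f)(z) / z` for a normalized `f`, its removable singularity at the
origin being filled with the limit `1`. -/
def besselBQuot (κ c : ℂ) (f : ℂ → ℂ) (z : ℂ) : ℂ :=
  if z = 0 then 1 else besselB κ c f z / z

/-- `p` is a solution of the differential subordination `φ(p(z), z p'(z)) ≺ h(z)`. -/
def IsSolution (φ : ℂ → ℂ → ℂ) (h p : ℂ → ℂ) : Prop :=
  DifferentiableOn ℂ p disk ∧ Subordinate (fun z => φ (p z) (z * deriv p z)) h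

/-- `q` is a dominant of the solutions of `φ(p(z), z p'(z)) ≺ h(z)`, where `h` is univalent. -/
def IsDominant (φ : ℂ → ℂ → ℂ) (h q : ℂ → ℂ) : Prop :=
  Univalent h ∧ Univalent q ∧ ∀ p : ℂ → ℂ, IsSolution φ h p → Subordinate p q

/-- `q` is the best dominant of `φ(p(z), z p'(z)) ≺ h(z)`. -/
def IsBestDominant (φ : ℂ → ℂ → ℂ) (h q : ℂ → ℂ) : Prop :=
  IsDominant φ h q ∧ ∀ q' : ℂ → ℂ, IsDominant φ h q' → Subordinate q q'

/-- `γ_κ = (1 + (κ+1)² - √(1 + (κ+1)⁴)) / (4 (κ+1))`. -/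
def gammaBound (κ : ℝ) : ℝ :=
  (1 + (κ + 1) ^ 2 - Real.sqrt (1 + (κ + 1) ^ 4)) / (4 * (κ + 1))

/-- The principal square root of a complex number. -/
def csqrt (z : ℂ) : ℂ := z ^ (1 / 2 : ℂ)

end BesselSubordination

end

open BesselSubordination

/-!
Put `k = κ + 1 > 0`. Comparing coefficients, `q = B_{κ+2,c}(g)(z) / z` solves the Briot–Bouquet
equation `q + z q' / k = Ψ` with `Ψ = B_{κ+1,c}(g)(z) / z` (`besselSeries_add_mul_deriv`), so the
statement concerns this equation only (`isBestDominant_of_re_gt_neg_gammaBound`).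

* Everything rests on Jack's lemma (`exists_mul_deriv_eq_of_norm_eq_one`): at a boundary point where
  an analytic function `f` on a closed disk has maximal modulus one, `z f' = m f` with a real `m`,
  which the Schwarz–Pick inequality bounds below in terms of `|f 0|`.
* Differentiating the equation gives `z P' + (k + J) P = k` for `P = q' / Ψ'`, where
  `J = 1 + z Ψ'' / Ψ'`. Jack's lemma for `2 P - 1` and `Re J > -γ_κ` keep `P` in the disk with
  diameter `[0, 1]`. Hence `1 + z q'' / q' = k / P - k` and `Ψ' / q' = 1 / P` have positive real part.
* The first of these says that the tangent angle of the image of a circle under `q` increases, by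
  `2π` in total, so the image lies on one side of each tangent
  (`LocallyConvex.re_sub_mul_conj_neg`). Therefore `q` is injective with convex image.
* The second says that `Ψ`, as a function of the variable `q` in this convex image, has a derivative
  with positive real part. Hence `Ψ` is injective, and it omits on `|z| ≤ |ζ|`, `z ≠ ζ`, the rays
  from `Ψ(ζ)` in the direction `ζ q'(ζ)` (`LocallyConvex.eq_of_eq_add_mul`).
* If `s + z s' / k ≺ Ψ` and `s` first left `q({|z| < ρ})` at `z₀`, Jack's lemma for `q⁻¹ ∘ s` would
  place `s + z s' / k` at `z₀` on such a ray (`LocallyConvex.subordinate`). So `s ≺ q`, and `q` is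
  the best dominant since it solves the subordination itself.

The statements on `u_{p,b,c}` are the case in which `Ψ` and `q` are affine. The Schwarz lemma turns
bounds on `|u - 1|` into subordinations, and the trigonometric functions are the series with
parameters `1/2`, `3/2` and `5/2`.
-/

namespace BesselSubordination

open Metric Set Filter Topology ComplexConjugate

/-! ### Jack's lemma -/

/-- The Schwarz–Pick growth estimate for analytic self-maps of the disk. -/
lemma norm_le_of_mapsTo_closedBall {f : ℂ → ℂ} {r : ℝ} (hr : 0 < r)
    (hf : DifferentiableOn ℂ f (ball 0 r)) (hb : ∀ z ∈ ball (0 : ℂ) r, ‖f z‖ ≤ 1)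
    {z : ℂ} (hz : z ∈ ball (0 : ℂ) r) :
    ‖f z‖ ≤ (‖f 0‖ + ‖z‖ / r) / (1 + ‖f 0‖ * (‖z‖ / r)) := by
  have h0 : (0 : ℂ) ∈ ball (0 : ℂ) r := mem_ball_self hr
  have ht0 : 0 ≤ ‖z‖ / r := by positivity
  have ht1 : ‖z‖ / r < 1 := by
    rw [div_lt_one hr]; simpa using hz
  set t := ‖z‖ / r with ht
  rcases (hb 0 h0).eq_or_lt with h1 | h1
  · rw [h1, one_mul, div_self (by positivity)]
    exact hb z hz
  set a := f 0 with ha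
  have hne : ∀ w ∈ ball (0 : ℂ) r, 1 - conj a * f w ≠ 0 := by
    intro w hw h
    have h2 : ‖conj a * f w‖ = 1 := by
      rw [← sub_eq_zero.mp h, norm_one]
    rw [norm_mul, RCLike.norm_conj] at h2
    nlinarith [hb w hw, norm_nonneg a, norm_nonneg (f w)]
  -- `|1 - conj a * w|² - |w - a|² = (1 - |a|²) (1 - |w|²)`
  have key : ∀ w : ℂ, ‖w - a‖ ^ 2 = ‖w‖ ^ 2 - 2 * (conj a * w).re + ‖a‖ ^ 2 ∧
      ‖1 - conj a * w‖ ^ 2 = 1 - 2 * (conj a * w).re + ‖a‖ ^ 2 * ‖w‖ ^ 2 := by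
    intro w
    simp only [← Complex.normSq_eq_norm_sq, Complex.normSq_apply]
    simp
    constructor <;> ring
  have hS := Complex.dist_le_div_mul_dist_of_mapsTo_ball
    (f := fun w => (f w - a) / (1 - conj a * f w)) (c := 0) (R₁ := r) (R₂ := 1) (z := z)
    ((hf.sub_const a).div ((hf.const_mul _).const_sub 1) hne) ?_ hz
  · rw [dist_eq_norm, dist_eq_norm] at hS
    simp only [← ha, sub_self, zero_div, sub_zero] at hS
    rw [norm_div, div_le_iff₀ (norm_pos_iff.mpr (hne z hz))] at hS
    have hS' : ‖f z - a‖ ≤ t * ‖1 - conj a * f z‖ := by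
      rwa [one_div_mul_eq_div] at hS
    have h3 : ‖f z - a‖ ^ 2 ≤ t ^ 2 * ‖1 - conj a * f z‖ ^ 2 := by
      rw [← mul_pow]; exact pow_le_pow_left₀ (norm_nonneg _) hS' 2
    rw [(key _).1, (key _).2] at h3
    have h4 : (conj a * f z).re ≤ ‖a‖ * ‖f z‖ := by
      refine (Complex.re_le_norm _).trans_eq ?_
      rw [norm_mul, RCLike.norm_conj]
    have h5 : 0 ≤ 1 - ‖a‖ * ‖f z‖ := by
      nlinarith [hb z hz, norm_nonneg a, norm_nonneg (f z)]
    have h6 : (‖f z‖ - ‖a‖) ^ 2 ≤ (t * (1 - ‖a‖ * ‖f z‖)) ^ 2 := by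
      nlinarith [mul_le_mul_of_nonneg_left h4 (by nlinarith : 0 ≤ 1 - t ^ 2)]
    have h7 := le_of_sq_le_sq h6 (by positivity)
    rw [le_div_iff₀ (by positivity)]
    nlinarith
  · intro w hw
    rw [mem_closedBall, dist_eq_norm]
    simp only [← ha, sub_self, zero_div, sub_zero]
    rw [norm_div, div_le_one (norm_pos_iff.mpr (hne w hw))]
    refine le_of_sq_le_sq ?_ (norm_nonneg _)
    rw [(key _).1, (key _).2]
    have := hb w hw
    nlinarith [mul_nonneg (by nlinarith [norm_nonneg a] : 0 ≤ 1 - ‖a‖ ^ 2)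
      (by nlinarith [norm_nonneg (f w)] : 0 ≤ 1 - ‖f w‖ ^ 2)]

/-- Jack's lemma, in the form valid for every value at the origin: where an analytic function on
a closed disk with values in the closed unit disk attains modulus one, its derivative along the
circle is tangent to the unit circle, and its radial derivative is bounded below. -/
lemma exists_mul_deriv_eq_of_norm_eq_one {f : ℂ → ℂ} {z₀ : ℂ} (hz₀ : z₀ ≠ 0)
    (hf : ∀ z, ‖z‖ ≤ ‖z₀‖ → DifferentiableAt ℂ f z) (hb : ∀ z, ‖z‖ ≤ ‖z₀‖ → ‖f z‖ ≤ 1)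
    (h1 : ‖f z₀‖ = 1) :
    ∃ m : ℝ, (1 - ‖f 0‖) / (1 + ‖f 0‖) ≤ m ∧ z₀ * deriv f z₀ = m * f z₀ := by
  have hr : 0 < ‖z₀‖ := norm_pos_iff.mpr hz₀
  have hd := (hf z₀ le_rfl).hasDerivAt
  set X := conj (f z₀) * (z₀ * deriv f z₀) with hX
  have hff : f z₀ * conj (f z₀) = 1 := by
    rw [Complex.mul_conj, Complex.normSq_eq_norm_sq, h1]; norm_num
  have hre : (1 - ‖f 0‖) / (1 + ‖f 0‖) ≤ X.re := by
    set a := ‖f 0‖ with ha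
    have ha0 : 0 ≤ a := norm_nonneg _
    have hφ : HasDerivAt (fun t : ℝ => (conj (f z₀) * f ((t : ℂ) * z₀)).re) X.re 1 := by
      have e : HasDerivAt (fun t : ℝ => conj (f z₀) * f ((t : ℂ) * z₀)) X 1 := by
        have h2 : HasDerivAt (fun t : ℝ => (t : ℂ) * z₀) z₀ 1 := by
          simpa using (Complex.ofRealCLM.hasDerivAt (x := (1 : ℝ))).mul_const z₀
        have h3 : HasDerivAt f (deriv f z₀) (((1 : ℝ) : ℂ) * z₀) := by simpa using hd
        have := (h3.scomp (1 : ℝ) h2).const_mul (conj (f z₀))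
        simpa [hX] using this
      exact Complex.reCLM.hasFDerivAt.comp_hasDerivAt (1 : ℝ) e
    have hψ : HasDerivAt (fun t : ℝ => (a + t) / (1 + a * t)) ((1 - a) / (1 + a)) 1 := by
      have h2 : HasDerivAt (fun t : ℝ => a + t) 1 1 := (hasDerivAt_id _).const_add a
      have h3 : HasDerivAt (fun t : ℝ => 1 + a * t) a 1 := by
        simpa using ((hasDerivAt_id (1 : ℝ)).const_mul a).const_add 1
      have hne : 1 + a * 1 ≠ 0 := by positivity
      have hne' : 1 + a ≠ 0 := by positivity
      have h4 := h2.div h3 hne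
      rwa [show (1 * (1 + a * 1) - (a + 1) * a) / (1 + a * 1) ^ 2 = (1 - a) / (1 + a) by
        rw [mul_one]; field_simp; ring] at h4
    have hlim := hasDerivWithinAt_iff_tendsto_slope.mp
      ((hψ.sub hφ).hasDerivWithinAt (s := Iio 1))
    have hev : ∀ᶠ t in 𝓝[Iio 1 \ {1}] (1 : ℝ), slope ((fun t : ℝ => (a + t) / (1 + a * t)) -
        fun t : ℝ => (conj (f z₀) * f ((t : ℂ) * z₀)).re) 1 t ≤ 0 := by
      have h0 : ∀ᶠ t in 𝓝[Iio 1 \ {1}] (1 : ℝ), 0 < t :=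
        nhdsWithin_le_nhds (lt_mem_nhds one_pos)
      filter_upwards [h0, self_mem_nhdsWithin] with t ht0 ht1
      have ht1 : t < 1 := ht1.1
      have hn : ‖(t : ℂ) * z₀‖ = t * ‖z₀‖ := by
        rw [norm_mul, Complex.norm_real, Real.norm_of_nonneg ht0.le]
      have hg := norm_le_of_mapsTo_closedBall (f := f) (z := t * z₀) hr
        (fun z hz => (hf z (by simpa using (mem_ball_zero_iff.mp hz).le)).differentiableWithinAt)
        (fun z hz => hb z (mem_ball_zero_iff.mp hz).le)
        (by rw [mem_ball_zero_iff, hn]; nlinarith)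
      rw [hn, mul_div_cancel_right₀ _ hr.ne', ← ha] at hg
      have h4 : (conj (f z₀) * f ((t : ℂ) * z₀)).re ≤ ‖f ((t : ℂ) * z₀)‖ := by
        refine (Complex.re_le_norm _).trans_eq ?_
        rw [norm_mul, RCLike.norm_conj, h1, one_mul]
      have h5 : (conj (f z₀) * f (((1 : ℝ) : ℂ) * z₀)).re = 1 := by
        rw [Complex.ofReal_one, one_mul, mul_comm, hff, Complex.one_re]
      rw [slope_def_field]
      refine div_nonpos_of_nonneg_of_nonpos ?_ (by linarith)
      simp only [Pi.sub_apply]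
      rw [h5, mul_one, add_comm 1 a, div_self (by positivity)]
      linarith
    have : (𝓝[Iio 1 \ {1}] (1 : ℝ)).NeBot := by
      rw [sdiff_singleton_eq_self (by simp)]; infer_instance
    have := le_of_tendsto hlim hev
    linarith
  have him : X.im = 0 := by
    have e : HasDerivAt (fun s : ℝ => f (exp (s * I) * z₀)) (I * (z₀ * deriv f z₀)) 0 := by
      have h2 : HasDerivAt (fun s : ℝ => exp (s * I) * z₀) (I * z₀) 0 := by
        have h3 : HasDerivAt (fun s : ℝ => (s : ℂ) * I) I 0 := by
          simpa using (Complex.ofRealCLM.hasDerivAt (x := (0 : ℝ))).mul_const I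
        simpa using (h3.cexp).mul_const z₀
      have h3 : HasDerivAt f (deriv f z₀) (exp (((0 : ℝ) : ℂ) * I) * z₀) := by simpa using hd
      have := h3.scomp (0 : ℝ) h2
      simpa [mul_assoc, Function.comp_def] using this
    have hsq := e.norm_sq
    have hmax : IsLocalMax (fun s : ℝ => ‖f (exp (s * I) * z₀)‖ ^ 2) 0 := by
      refine Eventually.of_forall fun s => ?_
      have h2 : ‖f (exp (s * I) * z₀)‖ ≤ 1 := hb _ (by
        rw [norm_mul, Complex.norm_exp_ofReal_mul_I, one_mul])
      have h3 : ‖f (exp (((0 : ℝ) : ℂ) * I) * z₀)‖ = 1 := by simpa using h1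
      simp only [h3]
      nlinarith [norm_nonneg (f (exp (s * I) * z₀))]
    have h0 := hmax.hasDerivAt_eq_zero hsq
    have h2 : inner ℝ (f z₀) (I * (z₀ * deriv f z₀)) = - X.im := by
      rw [Complex.inner, hX]
      simp
      ring
    simp [h2] at h0
    exact h0
  refine ⟨X.re, hre, ?_⟩
  have hXr : (X.re : ℂ) = X := by
    apply Complex.ext <;> simp [him]
  rw [hXr, hX]
  linear_combination (-(z₀ * deriv f z₀)) * hff

/-- If a continuous function on the disk does not map it into the open set `U`, there is a point
of minimal modulus at which it leaves `U`. -/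
lemma exists_first_exit {f : ℂ → ℂ} (hf : ContinuousOn f disk) {U : Set ℂ} (hU : IsOpen U)
    {z₁ : ℂ} (h₁ : z₁ ∈ disk) (hz₁ : f z₁ ∉ U) :
    ∃ z₀ ∈ disk, ‖z₀‖ ≤ ‖z₁‖ ∧ f z₀ ∉ U ∧ ∀ z, ‖z‖ < ‖z₀‖ → f z ∈ U := by
  have hsub : closedBall (0 : ℂ) ‖z₁‖ ⊆ disk := closedBall_subset_ball (by simpa [disk] using h₁)
  have hcl : IsClosed (closedBall (0 : ℂ) ‖z₁‖ ∩ f ⁻¹' Uᶜ) :=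
    (hf.mono hsub).preimage_isClosed_of_isClosed isClosed_closedBall hU.isClosed_compl
  have hK : IsCompact (closedBall (0 : ℂ) ‖z₁‖ ∩ f ⁻¹' Uᶜ) :=
    (isCompact_closedBall 0 ‖z₁‖).of_isClosed_subset hcl inter_subset_left
  obtain ⟨z₀, hz₀, hmin⟩ := hK.exists_isMinOn ⟨z₁, by simpa using hz₁⟩ continuous_norm.continuousOn
  have hle : ‖z₀‖ ≤ ‖z₁‖ := by simpa using hz₀.1
  refine ⟨z₀, hsub hz₀.1, hle, hz₀.2, fun z hz => ?_⟩
  by_contra h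
  have := hmin (show z ∈ closedBall (0 : ℂ) ‖z₁‖ ∩ f ⁻¹' Uᶜ from
    ⟨by simpa using (hz.le.trans hle), h⟩)
  exact absurd hz (not_lt.mpr this)

/-! ### The Briot–Bouquet equation -/

lemma isOpen_disk : IsOpen disk := isOpen_ball

lemma mem_disk {z : ℂ} : z ∈ disk ↔ ‖z‖ < 1 := mem_ball_zero_iff

lemma zero_mem_disk : (0 : ℂ) ∈ disk := mem_ball_self one_pos

lemma hasDerivAt_of_differentiableOn {f : ℂ → ℂ} (hf : DifferentiableOn ℂ f disk) {z : ℂ}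
    (hz : z ∈ disk) : HasDerivAt f (deriv f z) z :=
  (hf.differentiableAt (isOpen_disk.mem_nhds hz)).hasDerivAt

/-- `γ_κ` does not exceed the bound that the argument through Jack's lemma allows. -/
lemma two_mul_gammaBound_le {κ : ℝ} (hκ : -1 < κ) :
    2 * gammaBound κ ≤ (1 - |κ / (κ + 2)|) / (1 + |κ / (κ + 2)|) := by
  have h2 : 0 < κ + 2 := by linarith
  have h1 : 0 < κ + 1 := by linarith
  have hs1 : 1 ≤ √(1 + (κ + 1) ^ 4) := Real.one_le_sqrt.mpr (by nlinarith [pow_pos h1 4])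
  have hs2 : (κ + 1) ^ 2 ≤ √(1 + (κ + 1) ^ 4) := Real.le_sqrt_of_sq_le (by ring_nf; nlinarith)
  have e : 2 * gammaBound κ = (1 + (κ + 1) ^ 2 - √(1 + (κ + 1) ^ 4)) / (2 * (κ + 1)) := by
    unfold gammaBound; field_simp; ring
  rw [e, abs_div, abs_of_pos h2]
  rcases le_total 0 κ with h | h
  · rw [abs_of_nonneg h, show (1 - κ / (κ + 2)) / (1 + κ / (κ + 2)) = 1 / (κ + 1) by
      field_simp; ring, div_le_div_iff₀ (by positivity) (by positivity)]
    nlinarith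
  · rw [abs_of_nonpos h, show (1 - -κ / (κ + 2)) / (1 + -κ / (κ + 2)) = κ + 1 by
      field_simp; ring, div_le_iff₀ (by positivity)]
    nlinarith

section BriotBouquet

variable {k : ℝ} {h q : ℂ → ℂ}

lemma deriv_of_add_mul_deriv_div_eq (hk : 0 < k) (hq : DifferentiableOn ℂ q disk)
    (heq : ∀ z ∈ disk, q z + z * deriv q z / k = h z) {z : ℂ} (hz : z ∈ disk) :
    k * deriv h z = (k + 1) * deriv q z + z * deriv (deriv q) z := by
  have hk' : (k : ℂ) ≠ 0 := by exact_mod_cast hk.ne'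
  have h1 := hasDerivAt_of_differentiableOn hq hz
  have h2 := hasDerivAt_of_differentiableOn (hq.deriv isOpen_disk) hz
  have h3 := h1.add (((hasDerivAt_id z).mul h2).div_const (k : ℂ))
  have h4 : HasDerivAt h _ z := h3.congr_of_eventuallyEq
    (eventually_of_mem (isOpen_disk.mem_nhds hz) fun w hw => (heq w hw).symm)
  rw [h4.deriv]
  simp only [id]
  field_simp
  ring

/-- If `q + z q' / k = h` and `h` is close enough to being convex, then `q' / h'` takes its values
in the disk with diameter `[0, 1]`. -/
lemma norm_two_mul_deriv_div_sub_one_lt (hk : 0 < k) {δ : ℝ}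
    (hδ : 2 * δ ≤ (1 - |(k - 1) / (k + 1)|) / (1 + |(k - 1) / (k + 1)|))
    (hh : DifferentiableOn ℂ h disk) (hq : DifferentiableOn ℂ q disk)
    (heq : ∀ z ∈ disk, q z + z * deriv q z / k = h z)
    (hh0 : ∀ z ∈ disk, deriv h z ≠ 0)
    (hre : ∀ z ∈ disk, -δ < (z * deriv (deriv h) z / deriv h z + 1).re) {z : ℂ} (hz : z ∈ disk) :
    ‖2 * (deriv q z / deriv h z) - 1‖ < 1 := by
  set f : ℂ → ℂ := fun z => 2 * (deriv q z / deriv h z) - 1 with hf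
  have hfd : DifferentiableOn ℂ f disk :=
    (((hq.deriv isOpen_disk).div (hh.deriv isOpen_disk) hh0).const_mul 2).sub_const 1
  have hf0 : ‖f 0‖ = |(k - 1) / (k + 1)| := by
    have e := deriv_of_add_mul_deriv_div_eq hk hq heq zero_mem_disk
    have h1 := hh0 0 zero_mem_disk
    have h2 : ((k : ℂ) + 1) ≠ 0 := by exact_mod_cast (by positivity : k + 1 ≠ 0)
    have h3 : f 0 = (((k - 1) / (k + 1) : ℝ) : ℂ) := by
      rw [hf]; push_cast; field_simp; linear_combination (-2) * e
    rw [h3, Complex.norm_real, Real.norm_eq_abs]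
  have habs : |(k - 1) / (k + 1)| < 1 := by
    rw [abs_lt, lt_div_iff₀ (by positivity), div_lt_one (by positivity)]
    constructor <;> linarith
  by_contra hcon
  obtain ⟨z₀, hz₀, -, hz₀U, hlt⟩ := exists_first_exit hfd.continuousOn (U := ball 0 1) isOpen_ball
    hz (by simpa [hf] using hcon)
  have hz₀ne : z₀ ≠ 0 := by
    rintro rfl
    exact hz₀U (by simpa [hf0] using habs)
  have hmem : ∀ z, ‖z‖ ≤ ‖z₀‖ → z ∈ disk := fun z hz => mem_disk.mpr (hz.trans_lt (mem_disk.mp hz₀))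
  have hle : ∀ z, ‖z‖ ≤ ‖z₀‖ → ‖f z‖ ≤ 1 := by
    intro z hz
    have hcl : closure (ball (0 : ℂ) ‖z₀‖) = closedBall 0 ‖z₀‖ :=
      closure_ball 0 (norm_pos_iff.mpr hz₀ne).ne'
    have h1 : z ∈ closure (ball (0 : ℂ) ‖z₀‖) := by rw [hcl]; simpa using hz
    exact le_on_closure (f := fun z => ‖f z‖) (g := fun _ => (1 : ℝ))
      (fun w hw => (mem_ball_zero_iff.mp (hlt w (by simpa using hw))).le)
      ((hfd.continuousOn.mono (fun w hw => hmem w (by rw [hcl] at hw; simpa using hw))).norm)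
      continuousOn_const h1
  have hone : ‖f z₀‖ = 1 :=
    le_antisymm (hle z₀ le_rfl) (not_lt.mp fun h => hz₀U (by simpa using h))
  obtain ⟨m, hm, hmeq⟩ := exists_mul_deriv_eq_of_norm_eq_one hz₀ne
    (fun z hz => hfd.differentiableAt (isOpen_disk.mem_nhds (hmem z hz))) hle hone
  rw [hf0] at hm
  have hm0 : 0 ≤ m := le_trans (div_nonneg (by linarith) (by positivity)) hm
  have hJ := hre z₀ hz₀
  set J := z₀ * deriv (deriv h) z₀ / deriv h z₀ + 1 with hJdef
  set e := f z₀ with he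
  have hrel : 2 * k - (k + J) * (1 + e) = m * e := by
    rw [← hmeq]
    have h1 := (hasDerivAt_of_differentiableOn (hq.deriv isOpen_disk) hz₀)
    have h2 := (hasDerivAt_of_differentiableOn (hh.deriv isOpen_disk) hz₀)
    have h3 : HasDerivAt f _ z₀ := ((h1.div h2 (hh0 z₀ hz₀)).const_mul 2).sub_const 1
    have h4 := deriv_of_add_mul_deriv_div_eq hk hq heq hz₀
    have h5 := hh0 z₀ hz₀
    rw [h3.deriv, hJdef, he, hf]
    field_simp
    linear_combination 2 * deriv h z₀ * h4
  have hme : Complex.normSq e = 1 := by rw [Complex.normSq_eq_norm_sq, hone]; norm_num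
  rw [Complex.normSq_apply] at hme
  have hR := congrArg Complex.re hrel
  have hI := congrArg Complex.im hrel
  simp at hR hI
  -- `Re (k + J) |1 + e|² = (k - m / 2) |1 + e|²`
  have hfin : (k + J.re - (k - m / 2)) * (2 * (1 + e.re)) = 0 := by
    have h1 : (1 + e.re) ^ 2 + e.im ^ 2 = 2 * (1 + e.re) := by nlinarith
    linear_combination (-(1 + e.re)) * hR - e.im * hI - (k + J.re) * h1 - m * hme
  rcases mul_eq_zero.mp hfin with h1 | h1
  · linarith
  · have h2 : e.re = -1 := by linarith
    have h3 : e.im = 0 := by nlinarith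
    rw [h2, h3] at hR
    simp at hR
    linarith

/-- The three consequences of `q' / h'` having values in the disk with diameter `[0, 1]`: `q` is
locally univalent, its curvature functional has positive real part, and `h` is close-to-convex
with respect to `q`. -/
lemma re_one_add_mul_deriv_div_pos (hk : 0 < k) (hq : DifferentiableOn ℂ q disk)
    (heq : ∀ z ∈ disk, q z + z * deriv q z / k = h z)
    {z : ℂ} (hz : z ∈ disk) (hP : ‖2 * (deriv q z / deriv h z) - 1‖ < 1) :
    deriv q z ≠ 0 ∧ 0 < (1 + z * deriv (deriv q) z / deriv q z).re ∧
      0 < (deriv h z / deriv q z).re := by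
  have hq0 : deriv q z ≠ 0 := by
    intro h0
    simp [h0] at hP
  have hh0 : deriv h z ≠ 0 := by
    intro h0
    simp [h0] at hP
  set P := deriv q z / deriv h z with hPdef
  have hP0 : P ≠ 0 := div_ne_zero hq0 hh0
  have hone : 1 < (P⁻¹).re := by
    have h1 : ‖2 * P - 1‖ ^ 2 < 1 := by nlinarith [norm_nonneg (2 * P - 1)]
    rw [← Complex.normSq_eq_norm_sq, Complex.normSq_apply] at h1
    simp at h1
    rw [Complex.inv_re, lt_div_iff₀ (Complex.normSq_pos.mpr hP0), Complex.normSq_apply]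
    nlinarith
  have hinv : deriv h z / deriv q z = P⁻¹ := by rw [hPdef, inv_div]
  have hQ : 1 + z * deriv (deriv q) z / deriv q z = k * P⁻¹ - k := by
    have := deriv_of_add_mul_deriv_div_eq hk hq heq hz
    rw [← hinv]
    field_simp
    linear_combination -this
  refine ⟨hq0, ?_, by rw [hinv]; linarith⟩
  rw [hQ, Complex.sub_re, Complex.re_ofReal_mul, Complex.ofReal_re]
  nlinarith

end BriotBouquet

/-! ### Locally convex functions: tangents and injectivity -/

/-- A non-vanishing analytic function on the disk is `exp F`, with `F'` its logarithmic
derivative. -/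
lemma exists_eq_exp {g : ℂ → ℂ} (hg : DifferentiableOn ℂ g disk) (hg0 : ∀ z ∈ disk, g z ≠ 0) :
    ∃ F : ℂ → ℂ, (∀ z ∈ disk, HasDerivAt F (deriv g z / g z) z) ∧ ∀ z ∈ disk, g z = exp (F z) := by
  obtain ⟨F, hF0, hF⟩ := (DifferentiableOn.isExactOn_ball
    ((hg.deriv isOpen_disk).div hg hg0)).with_val_at 0 (log (g 0))
  refine ⟨F, hF, fun z hz => ?_⟩
  have hd : ∀ w ∈ disk, HasDerivAt (fun w => g w * exp (-F w)) 0 w := by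
    intro w hw
    refine ((hasDerivAt_of_differentiableOn hg hw).mul (hF w hw).neg.cexp).congr_deriv ?_
    have := hg0 w hw
    simp only [Pi.div_apply, Pi.neg_apply]
    field_simp
    ring
  have hc := isOpen_disk.is_const_of_deriv_eq_zero (convex_ball (0 : ℂ) 1).isPreconnected
    (fun w hw => (hd w hw).differentiableAt.differentiableWithinAt)
    (fun w hw => (hd w hw).deriv) hz zero_mem_disk
  simp only [hF0, Complex.exp_neg, Complex.exp_log (hg0 0 zero_mem_disk),
    mul_inv_cancel₀ (hg0 0 zero_mem_disk)] at hc
  exact eq_of_div_eq_one hc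

/-- `q` is locally univalent in the disk and maps each circle about the origin to a curve of
positive curvature. -/
structure LocallyConvex (q : ℂ → ℂ) : Prop where
  differentiableOn : DifferentiableOn ℂ q disk
  deriv_ne_zero : ∀ z ∈ disk, deriv q z ≠ 0
  re_pos : ∀ z ∈ disk, 0 < (1 + z * deriv (deriv q) z / deriv q z).re

namespace LocallyConvex

variable {q : ℂ → ℂ} (hq : LocallyConvex q)
include hq

/-- The tangent angle of the image of a circle increases from `0` to `2π` along the circle, so the
curve lies on one side of each of its tangents. -/
lemma re_sub_mul_conj_neg_of_norm_eq {z ζ : ℂ} (hζ : ζ ∈ disk) (hzζ : ‖z‖ = ‖ζ‖) (hne : z ≠ ζ) :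
    ((q z - q ζ) * conj (ζ * deriv q ζ)).re < 0 := by
  have hζ0 : ζ ≠ 0 := by
    rintro rfl
    exact hne (by simpa using hzζ)
  obtain ⟨F, hF, hexp⟩ := exists_eq_exp (hq.differentiableOn.deriv isOpen_disk) hq.deriv_ne_zero
  set w : ℝ → ℂ := fun s => ζ * exp (s * I) with hw
  have hwd : ∀ s, w s ∈ disk := fun s => by
    rw [mem_disk, hw]; simpa [Complex.norm_exp_ofReal_mul_I] using mem_disk.mp hζ
  have hwderiv : ∀ s, HasDerivAt w (I * w s) s := by
    intro s
    have h3 : HasDerivAt (fun s : ℝ => (s : ℂ) * I) I s := by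
      simpa using (Complex.ofRealCLM.hasDerivAt (x := s)).mul_const I
    refine (h3.cexp.const_mul ζ).congr_deriv ?_
    rw [hw]; ring
  have hw0 : w 0 = ζ := by simp [hw]
  have hw2 : w (2 * Real.pi) = ζ := by simp [hw]
  -- the tangent angle, measured from that at `ζ`
  set ψ : ℝ → ℝ := fun s => s + (F (w s)).im - (F ζ).im with hψ
  have hψd : ∀ s, HasDerivAt ψ (1 + w s * deriv (deriv q) (w s) / deriv q (w s)).re s := by
    intro s
    have h1 := (hF (w s) (hwd s)).scomp s (hwderiv s)
    have h2 : HasDerivAt (fun s => (F (w s)).im) _ s :=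
      Complex.imCLM.hasFDerivAt.comp_hasDerivAt s h1
    refine (((hasDerivAt_id s).add h2).sub_const (F ζ).im).congr_deriv ?_
    simp only [Complex.imCLM_apply, smul_eq_mul, Complex.add_re, Complex.one_re]
    congr 1
    rw [mul_assoc, Complex.I_mul_im]
    congr 1
    ring
  have hψm : StrictMono ψ := strictMono_of_deriv_pos fun s => by
    rw [(hψd s).deriv]; exact hq.re_pos _ (hwd s)
  have hψ0 : ψ 0 = 0 := by simp [hψ, hw0]
  have hψ2 : ψ (2 * Real.pi) = 2 * Real.pi := by simp [hψ, hw2]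
  have hψc : Continuous ψ := continuous_iff_continuousAt.mpr fun s => (hψd s).continuousAt
  obtain ⟨s₁, -, hs₁⟩ := intermediate_value_Icc (by positivity : (0 : ℝ) ≤ 2 * Real.pi)
    hψc.continuousOn (show Real.pi ∈ Icc (ψ 0) (ψ (2 * Real.pi)) by
      rw [hψ0, hψ2]; constructor <;> linarith [Real.pi_pos])
  set χ : ℝ → ℝ := fun s => ((q (w s) - q ζ) * conj (ζ * deriv q ζ)).re with hχ
  have hχd : ∀ s, HasDerivAt χ
      (-(‖ζ‖ ^ 2 * Real.exp ((F (w s)).re + (F ζ).re) * Real.sin (ψ s))) s := by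
    intro s
    have h1 := (hasDerivAt_of_differentiableOn hq.differentiableOn (hwd s)).scomp s (hwderiv s)
    have h2 : HasDerivAt χ _ s := Complex.reCLM.hasFDerivAt.comp_hasDerivAt s
      ((h1.sub_const (q ζ)).mul_const (conj (ζ * deriv q ζ)))
    refine h2.congr_deriv ?_
    rw [hexp _ (hwd s), hexp _ hζ]
    simp only [Complex.reCLM_apply, smul_eq_mul]
    have e : I * w s * exp (F (w s)) * conj (ζ * exp (F ζ)) =
        I * (((‖ζ‖ ^ 2 : ℝ) : ℂ) *
          exp (((F (w s)).re + (F ζ).re : ℝ) + (ψ s : ℝ) * I)) := by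
      have e1 : (((F (w s)).re + (F ζ).re : ℝ) : ℂ) + (ψ s : ℝ) * I =
          s * I + F (w s) + conj (F ζ) := by
        apply Complex.ext <;> simp [hψ]; ring
      rw [e1, Complex.exp_add, Complex.exp_add, map_mul, ← Complex.exp_conj,
        ← Complex.normSq_eq_norm_sq, Complex.normSq_eq_conj_mul_self, hw]
      ring
    rw [e, Complex.I_mul_re, Complex.im_ofReal_mul, Complex.exp_im]
    simp
    ring
  have hχc : Continuous χ := continuous_iff_continuousAt.mpr fun s => (hχd s).continuousAt
  have hpos : ∀ s, 0 < ‖ζ‖ ^ 2 * Real.exp ((F (w s)).re + (F ζ).re) := fun s => by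
    have := norm_pos_iff.mpr hζ0
    positivity
  have hanti : StrictAntiOn χ (Icc 0 s₁) := by
    refine strictAntiOn_of_deriv_neg (convex_Icc _ _) hχc.continuousOn fun s hs => ?_
    rw [interior_Icc] at hs
    rw [(hχd s).deriv, neg_neg_iff_pos]
    exact mul_pos (hpos s) (Real.sin_pos_of_pos_of_lt_pi (hψ0 ▸ hψm hs.1) (hs₁ ▸ hψm hs.2))
  have hmono : StrictMonoOn χ (Icc s₁ (2 * Real.pi)) := by
    refine strictMonoOn_of_deriv_pos (convex_Icc _ _) hχc.continuousOn fun s hs => ?_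
    rw [interior_Icc] at hs
    rw [(hχd s).deriv, Left.neg_pos_iff]
    refine mul_neg_of_pos_of_neg (hpos s) ?_
    have h1 : Real.pi < ψ s := hs₁ ▸ hψm hs.1
    have h2 : ψ s < 2 * Real.pi := by rw [← hψ2]; exact hψm hs.2
    have h3 := Real.sin_neg_of_neg_of_neg_pi_lt (x := ψ s - 2 * Real.pi)
      (by linarith) (by linarith)
    rwa [Real.sin_sub_two_pi] at h3
  have hneg : ∀ s, 0 < s → s < 2 * Real.pi → χ s < 0 := by
    intro s hs0 hs2
    rcases le_total s s₁ with h | h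
    · have := hanti ⟨le_rfl, hs0.le.trans h⟩ ⟨hs0.le, h⟩ hs0
      simpa [hχ, hw0] using this
    · have := hmono ⟨h, hs2.le⟩ ⟨h.trans hs2.le, le_rfl⟩ hs2
      simpa [hχ, hw2] using this
  have hu : ‖z / ζ‖ = 1 := by
    rw [norm_div, hzζ, div_self (norm_ne_zero_iff.mpr hζ0)]
  have harg : exp (arg (z / ζ) * I) = z / ζ := by
    have := Complex.norm_mul_exp_arg_mul_I (z / ζ)
    rwa [hu, Complex.ofReal_one, one_mul] at this
  have hwz : w (arg (z / ζ)) = z := by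
    rw [hw]; simp only [harg]; field_simp
  have hwz' : w (arg (z / ζ) + 2 * Real.pi) = z := by
    refine Eq.trans ?_ hwz
    simp [hw, add_mul, Complex.exp_add]
  have harg0 : arg (z / ζ) ≠ 0 := by
    intro h0
    rw [h0, hw0] at hwz
    exact hne hwz.symm
  rcases lt_or_gt_of_ne harg0 with h | h
  · have h1 := hneg (arg (z / ζ) + 2 * Real.pi)
      (by linarith [Complex.neg_pi_lt_arg (z / ζ), Real.pi_pos]) (by linarith)
    simpa only [hχ, hwz'] using h1
  · have h1 := hneg (arg (z / ζ)) h (by linarith [Complex.arg_le_pi (z / ζ), Real.pi_pos])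
    simpa only [hχ, hwz] using h1

/-- The image of a closed disk about the origin lies, apart from the point of contact, strictly on
the inner side of each tangent to its boundary. -/
lemma re_sub_mul_conj_neg {z ζ : ℂ} (hζ : ζ ∈ disk) (hzζ : ‖z‖ ≤ ‖ζ‖) (hne : z ≠ ζ) :
    ((q z - q ζ) * conj (ζ * deriv q ζ)).re < 0 := by
  rcases hzζ.eq_or_lt with h | h
  · exact hq.re_sub_mul_conj_neg_of_norm_eq hζ h hne
  have hζ0 : ζ ≠ 0 := norm_pos_iff.mp ((norm_nonneg z).trans_lt h)
  have hr := norm_ne_zero_iff.mpr hζ0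
  set G : ℂ → ℂ := fun z => exp ((q z - q ζ) * conj (ζ * deriv q ζ)) with hG
  have hsub : closedBall (0 : ℂ) ‖ζ‖ ⊆ disk := closedBall_subset_ball (mem_disk.mp hζ)
  have hGd : DiffContOnCl ℂ G (ball 0 ‖ζ‖) := by
    refine DifferentiableOn.diffContOnCl ?_
    rw [closure_ball _ hr]
    exact (((hq.differentiableOn.mono hsub).sub_const _).mul_const _).cexp
  have hfr : ∀ w ∈ frontier (ball (0 : ℂ) ‖ζ‖), ‖G w‖ ≤ 1 := by
    intro w hw
    rw [frontier_ball _ hr] at hw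
    rw [hG, Complex.norm_exp, Real.exp_le_one_iff]
    by_cases hwζ : w = ζ
    · simp [hwζ]
    · exact (hq.re_sub_mul_conj_neg_of_norm_eq hζ (by simpa using hw) hwζ).le
  have hle : ∀ w ∈ closure (ball (0 : ℂ) ‖ζ‖), ‖G w‖ ≤ 1 := fun w hw =>
    Complex.norm_le_of_forall_mem_frontier_norm_le isBounded_ball hGd hfr hw
  by_contra hcon
  have hz1 : 1 ≤ ‖G z‖ := by
    rw [hG, Complex.norm_exp, Real.one_le_exp_iff]; exact not_lt.mp hcon
  have hEq := Complex.norm_eqOn_closure_of_isPreconnected_of_isMaxOn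
    (convex_ball (0 : ℂ) ‖ζ‖).isPreconnected isOpen_ball hGd (by simpa using h)
    (fun w hw => (hle w (subset_closure hw)).trans hz1)
  have h1 := hEq (x := -ζ) (by rw [closure_ball _ hr]; simp)
  have h2 := hq.re_sub_mul_conj_neg_of_norm_eq (z := -ζ) hζ (by simp)
    (by simpa [neg_eq_iff_add_eq_zero, ← two_mul] using hζ0)
  have h3 : ‖G (-ζ)‖ < 1 := by rw [hG, Complex.norm_exp, Real.exp_lt_one_iff]; exact h2
  simp only [Function.comp, Function.const] at h1
  linarith

lemma injOn : InjOn q disk := by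
  have key : ∀ z ∈ disk, ∀ ζ ∈ disk, ‖z‖ ≤ ‖ζ‖ → q z = q ζ → z = ζ := by
    intro z _ ζ hζ hle he
    by_contra hne
    have := hq.re_sub_mul_conj_neg hζ hle hne
    simp [he] at this
  intro z hz ζ hζ he
  rcases le_total ‖z‖ ‖ζ‖ with h | h
  · exact key z hz ζ hζ h he
  · exact (key ζ hζ z hz h he.symm).symm

end LocallyConvex

/-! ### Convexity of the image, and subordination -/

namespace LocallyConvex

variable {q : ℂ → ℂ} (hq : LocallyConvex q)
include hq

/-- At the point of the image of a closed disk nearest to a point `v` outside of it, `v` lies in the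
direction of the outer normal, hence `v` is separated from the image by the tangent there. -/
lemma convex_image_closedBall {ρ : ℝ} (hρ0 : 0 < ρ) (hρ1 : ρ < 1) :
    Convex ℝ (q '' closedBall 0 ρ) := by
  rw [convex_iff_segment_subset]
  rintro _ ⟨z₁, hz₁, rfl⟩ _ ⟨z₂, hz₂, rfl⟩ v hv
  by_contra hcon
  have hsub : closedBall (0 : ℂ) ρ ⊆ disk := closedBall_subset_ball hρ1
  have hne : ∀ z ∈ closedBall (0 : ℂ) ρ, v - q z ≠ 0 := fun z hz h0 =>
    hcon ⟨z, hz, (sub_eq_zero.mp h0).symm⟩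
  have hd : DifferentiableOn ℂ (fun z => (v - q z)⁻¹) (closedBall 0 ρ) :=
    ((hq.differentiableOn.mono hsub).const_sub v).inv hne
  obtain ⟨ζ, hζ, hmax⟩ := Complex.exists_mem_frontier_isMaxOn_norm
    (isBounded_ball (x := (0 : ℂ)) (r := ρ)) ⟨0, mem_ball_self hρ0⟩
    (DifferentiableOn.diffContOnCl (by rwa [closure_ball _ hρ0.ne']))
  rw [frontier_ball _ hρ0.ne', mem_sphere_zero_iff_norm] at hζ
  rw [closure_ball _ hρ0.ne'] at hmax
  have hζ0 : ζ ≠ 0 := by rintro rfl; simp at hζ; linarith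
  have hmem : ∀ z, ‖z‖ ≤ ‖ζ‖ → z ∈ closedBall (0 : ℂ) ρ := fun z hz => by
    simpa [hζ] using hz
  have hζm := hmem ζ le_rfl
  have hu := hne ζ hζm
  have hfd : ∀ z, ‖z‖ ≤ ‖ζ‖ → HasDerivAt (fun z => (v - q ζ) * (v - q z)⁻¹)
      ((v - q ζ) * (deriv q z / (v - q z) ^ 2)) z := fun z hz => by
    have h1 := (hasDerivAt_of_differentiableOn hq.differentiableOn
      (hsub (hmem z hz))).const_sub v
    simpa using (h1.fun_inv (hne z (hmem z hz))).const_mul (v - q ζ)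
  obtain ⟨m, hm, hmeq⟩ := exists_mul_deriv_eq_of_norm_eq_one
    (f := fun z => (v - q ζ) * (v - q z)⁻¹) hζ0 (fun z hz => (hfd z hz).differentiableAt)
    (fun z hz => by
      have h1 : ‖(v - q z)⁻¹‖ ≤ ‖(v - q ζ)⁻¹‖ := hmax (hmem z hz)
      calc ‖(v - q ζ) * (v - q z)⁻¹‖ ≤ ‖v - q ζ‖ * ‖(v - q ζ)⁻¹‖ := by
            rw [norm_mul]; gcongr
        _ = 1 := by rw [← norm_mul, mul_inv_cancel₀ hu, norm_one])
    (by simp only [mul_inv_cancel₀ hu, norm_one])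
  have h0le : ‖(v - q ζ) * (v - q 0)⁻¹‖ ≤ 1 := by
    have h1 : ‖(v - q 0)⁻¹‖ ≤ ‖(v - q ζ)⁻¹‖ := hmax (hmem 0 (by simp))
    calc ‖(v - q ζ) * (v - q 0)⁻¹‖ ≤ ‖v - q ζ‖ * ‖(v - q ζ)⁻¹‖ := by
          rw [norm_mul]; gcongr
      _ = 1 := by rw [← norm_mul, mul_inv_cancel₀ hu, norm_one]
  have hm0 : 0 ≤ m := le_trans (div_nonneg (by linarith) (by positivity)) hm
  have hν : ζ * deriv q ζ = m * (v - q ζ) := by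
    rw [(hfd ζ le_rfl).deriv, mul_inv_cancel₀ hu, mul_one] at hmeq
    field_simp at hmeq
    linear_combination hmeq
  have hmpos : 0 < m := by
    refine lt_of_le_of_ne hm0 fun h0 => ?_
    rw [← h0] at hν
    simp [hζ0, hq.deriv_ne_zero ζ (hsub hζm)] at hν
  -- `v` is a convex combination of points on the inner side of the tangent at `q ζ`
  have hin : ∀ z ∈ closedBall (0 : ℂ) ρ,
      ((q z - q ζ) * conj (ζ * deriv q ζ)).re ≤ 0 := by
    intro z hz
    by_cases h : z = ζ
    · simp [h]
    · exact (hq.re_sub_mul_conj_neg (hsub hζm) (by simpa [hζ] using hz) h).le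
  obtain ⟨a, b, ha, hb, hab, hv⟩ := hv
  have hvle : ((v - q ζ) * conj (ζ * deriv q ζ)).re ≤ 0 := by
    have e : (v - q ζ) * conj (ζ * deriv q ζ) =
        a * ((q z₁ - q ζ) * conj (ζ * deriv q ζ)) + b * ((q z₂ - q ζ) * conj (ζ * deriv q ζ)) := by
      have hab' : (a : ℂ) + b = 1 := by exact_mod_cast hab
      rw [← hv, Complex.real_smul, Complex.real_smul]
      linear_combination (q ζ * conj (ζ * deriv q ζ)) * hab'
    rw [e, Complex.add_re, Complex.re_ofReal_mul, Complex.re_ofReal_mul]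
    nlinarith [mul_nonneg ha (neg_nonneg.mpr (hin z₁ hz₁)),
      mul_nonneg hb (neg_nonneg.mpr (hin z₂ hz₂))]
  rw [hν, map_mul, Complex.conj_ofReal, mul_left_comm, Complex.re_ofReal_mul, Complex.mul_conj,
    Complex.ofReal_re] at hvle
  nlinarith [mul_pos hmpos (Complex.normSq_pos.mpr hu)]

lemma convex_image_disk : Convex ℝ (q '' disk) := by
  rw [convex_iff_segment_subset]
  rintro _ ⟨z₁, hz₁, rfl⟩ _ ⟨z₂, hz₂, rfl⟩
  rw [mem_disk] at hz₁ hz₂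
  have h1 : max ‖z₁‖ ‖z₂‖ < 1 := max_lt hz₁ hz₂
  have h0 : 0 ≤ max ‖z₁‖ ‖z₂‖ := le_max_of_le_left (norm_nonneg _)
  have hc := hq.convex_image_closedBall (ρ := (1 + max ‖z₁‖ ‖z₂‖) / 2) (by linarith) (by linarith)
  refine (hc.segment_subset (mem_image_of_mem q ?_) (mem_image_of_mem q ?_)).trans
    (image_mono (closedBall_subset_ball (by linarith)))
  · rw [mem_closedBall_zero_iff]; linarith [le_max_left ‖z₁‖ ‖z₂‖]
  · rw [mem_closedBall_zero_iff]; linarith [le_max_right ‖z₁‖ ‖z₂‖]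

lemma hasStrictDerivAt {z : ℂ} (hz : z ∈ disk) : HasStrictDerivAt q (deriv q z) z :=
  (hq.differentiableOn.analyticAt (isOpen_disk.mem_nhds hz)).hasStrictDerivAt

lemma isOpen_image {U : Set ℂ} (hU : IsOpen U) (hUd : U ⊆ disk) : IsOpen (q '' U) := by
  rw [isOpen_iff_mem_nhds]
  rintro _ ⟨z, hz, rfl⟩
  rw [← (hq.hasStrictDerivAt (hUd hz)).map_nhds_eq (hq.deriv_ne_zero z (hUd hz))]
  exact image_mem_map (hU.mem_nhds hz)

/-- `q` has an analytic inverse. -/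
lemma exists_inverse : ∃ g : ℂ → ℂ, (∀ z ∈ disk, g (q z) = z) ∧
    ∀ z ∈ disk, HasDerivAt g (deriv q z)⁻¹ (q z) := by
  refine ⟨Function.invFunOn q disk, fun z hz => hq.injOn.leftInvOn_invFunOn hz, fun z hz => ?_⟩
  exact ((hq.hasStrictDerivAt hz).to_local_left_inverse (hq.deriv_ne_zero z hz)
    (eventually_of_mem (isOpen_disk.mem_nhds hz)
      fun w hw => hq.injOn.leftInvOn_invFunOn hw)).hasDerivAt

/-- The Noshiro–Warschawski argument for a function `h` that is close-to-convex with respect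
to `q`: as a function of the variable `q`, on a convex domain, `h` has a derivative with positive
real part, and so have its difference quotients. -/
lemma re_div_sub_pos {h : ℂ → ℂ} (hh : DifferentiableOn ℂ h disk)
    (hcc : ∀ z ∈ disk, 0 < (deriv h z / deriv q z).re) {z ζ : ℂ} (hz : z ∈ disk) (hζ : ζ ∈ disk)
    (hne : z ≠ ζ) : 0 < ((h z - h ζ) / (q z - q ζ)).re := by
  obtain ⟨g, hg, hgd⟩ := hq.exists_inverse
  set d := q z - q ζ with hd
  have hd0 : d ≠ 0 := sub_ne_zero.mpr fun e => hne (hq.injOn hz hζ e)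
  set φ : ℝ → ℝ := fun t => (h (g (q ζ + t * d)) / d).re with hφ
  have hφd : ∀ t ∈ Icc (0 : ℝ) 1, ∃ x : ℝ, 0 < x ∧ HasDerivAt φ x t := by
    intro t ht
    have hmem : q ζ + t * d ∈ q '' disk := by
      have := hq.convex_image_disk.add_smul_sub_mem (mem_image_of_mem q hζ)
        (mem_image_of_mem q hz) ht
      simpa [hd, Complex.real_smul] using this
    obtain ⟨w, hw, hwe⟩ := hmem
    have h1 : HasDerivAt (fun t : ℝ => q ζ + t * d) d t := by
      simpa using ((Complex.ofRealCLM.hasDerivAt (x := t)).mul_const d).const_add (q ζ)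
    have h2 : HasDerivAt (fun v => h (g v)) (deriv h w * (deriv q w)⁻¹) (q ζ + t * d) := by
      have h3 := hgd w hw
      have h4 : HasDerivAt h (deriv h w) (g (q w)) := by
        rw [hg w hw]; exact hasDerivAt_of_differentiableOn hh hw
      rw [← hwe]
      exact h4.comp _ h3
    have h5 : HasDerivAt φ _ t :=
      Complex.reCLM.hasFDerivAt.comp_hasDerivAt t ((h2.scomp t h1).div_const d)
    refine ⟨(deriv h w / deriv q w).re, hcc w hw, h5.congr_deriv ?_⟩
    simp only [Complex.reCLM_apply, smul_eq_mul]
    congr 1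
    field_simp
  have hmono : StrictMonoOn φ (Icc 0 1) := by
    refine strictMonoOn_of_deriv_pos (convex_Icc _ _) (fun t ht => ?_) fun t ht => ?_
    · obtain ⟨x, -, hx⟩ := hφd t ht
      exact hx.continuousAt.continuousWithinAt
    · obtain ⟨x, hx0, hx⟩ := hφd t (interior_subset ht)
      rwa [hx.deriv]
  have hlt := hmono (left_mem_Icc.mpr zero_le_one) (right_mem_Icc.mpr zero_le_one) one_pos
  simp only [hφ, Complex.ofReal_zero, zero_mul, add_zero, Complex.ofReal_one, one_mul, hd,
    add_sub_cancel, hg z hz, hg ζ hζ] at hlt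
  rw [sub_div, Complex.sub_re]
  exact sub_pos.mpr hlt

/-- The ray issuing from `h ζ` in the direction of the outer normal of `q` at `ζ` avoids the other
values of `h` on the closed disk of radius `‖ζ‖`. -/
lemma eq_of_eq_add_mul {h : ℂ → ℂ} (hh : DifferentiableOn ℂ h disk)
    (hcc : ∀ z ∈ disk, 0 < (deriv h z / deriv q z).re) {z ζ : ℂ} (hζ : ζ ∈ disk)
    (hzζ : ‖z‖ ≤ ‖ζ‖) {s : ℝ} (hs : 0 ≤ s) (he : h z = h ζ + s * (ζ * deriv q ζ)) : z = ζ := by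
  by_contra hne
  have hz : z ∈ disk := mem_disk.mpr (hzζ.trans_lt (mem_disk.mp hζ))
  have hA := hq.re_div_sub_pos hh hcc hz hζ hne
  have hc := hq.re_sub_mul_conj_neg hζ hzζ hne
  have hd0 : q z - q ζ ≠ 0 := sub_ne_zero.mpr fun e => hne (hq.injOn hz hζ e)
  set d := q z - q ζ with hd
  set ν := ζ * deriv q ζ with hν
  rw [he, add_sub_cancel_left] at hA
  -- `Re (s ν / d)` and `s Re (d conj ν)` have the same sign
  have e : (s * ν / d).re * Complex.normSq d = s * (d * conj ν).re := by
    have := (Complex.normSq_pos.mpr hd0).ne'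
    rw [Complex.div_re, Complex.re_ofReal_mul, Complex.im_ofReal_mul,
      Complex.mul_re d, Complex.conj_re, Complex.conj_im]
    field_simp
    ring
  nlinarith [mul_pos hA (Complex.normSq_pos.mpr hd0), mul_nonneg hs (neg_nonneg.mpr hc.le)]

end LocallyConvex

/-- The subordination principle for the differential operator `s + z s' / k`: a first point at
which `s` leaves the image under `q` of a disk would, by Jack's lemma, put a value of `h` on one of
the rays that `h` avoids. -/
lemma LocallyConvex.subordinate {k : ℝ} (hk : 0 < k) {h q s : ℂ → ℂ} (hq : LocallyConvex q)
    (hh : DifferentiableOn ℂ h disk) (hcc : ∀ z ∈ disk, 0 < (deriv h z / deriv q z).re)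
    (heq : ∀ z ∈ disk, q z + z * deriv q z / k = h z) (hs : DifferentiableOn ℂ s disk)
    (hsub : Subordinate (fun z => s z + z * deriv s z / k) h) : Subordinate s q := by
  obtain ⟨w, -, hwle, hw⟩ := hsub
  obtain ⟨g, hg, hgd⟩ := hq.exists_inverse
  have hs0 : s 0 = q 0 := by
    have h1 := hw 0 zero_mem_disk
    have h2 : w 0 = 0 := by simpa using hwle 0 zero_mem_disk
    rw [h2, ← heq 0 zero_mem_disk] at h1
    simpa using h1
  have hωd : ∀ z ∈ disk, s z ∈ q '' disk → DifferentiableAt ℂ (fun z => g (s z)) z := by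
    rintro z hz ⟨ζ, hζ, hζe⟩
    have h1 := hgd ζ hζ
    rw [hζe] at h1
    exact (h1.comp z (hasDerivAt_of_differentiableOn hs hz)).differentiableAt
  have hmain : ∀ ρ : ℝ, ρ < 1 → ∀ z, ‖z‖ < ρ → s z ∈ q '' ball 0 ρ := by
    intro ρ hρ1 z₁ hz₁
    by_contra hcon
    have hρ0 : 0 < ρ := (norm_nonneg _).trans_lt hz₁
    have hbsub : closedBall (0 : ℂ) ρ ⊆ disk := closedBall_subset_ball hρ1
    obtain ⟨z₀, hz₀, hz₀le, hz₀U, hlt⟩ := exists_first_exit hs.continuousOn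
      (hq.isOpen_image isOpen_ball (ball_subset_closedBall.trans hbsub))
      (mem_disk.mpr (hz₁.trans hρ1)) hcon
    have hz₀ne : z₀ ≠ 0 := by
      rintro rfl
      exact hz₀U ⟨0, mem_ball_self hρ0, hs0.symm⟩
    have hmem : ∀ z, ‖z‖ ≤ ‖z₀‖ → z ∈ disk := fun z hz =>
      mem_disk.mpr (hz.trans_lt (mem_disk.mp hz₀))
    have himg : ∀ z, ‖z‖ ≤ ‖z₀‖ → s z ∈ q '' closedBall 0 ρ := by
      intro z hz
      have hcl : closure (ball (0 : ℂ) ‖z₀‖) = closedBall 0 ‖z₀‖ :=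
        closure_ball 0 (norm_pos_iff.mpr hz₀ne).ne'
      have hc : ContinuousOn s (closure (ball 0 ‖z₀‖)) := hs.continuousOn.mono fun w hw =>
        hmem w (by rw [hcl] at hw; simpa using hw)
      have h1 : s z ∈ closure (s '' ball 0 ‖z₀‖) :=
        hc.image_closure (mem_image_of_mem s (by rw [hcl]; simpa using hz))
      refine closure_minimal ?_ ((isCompact_closedBall (0 : ℂ) ρ).image_of_continuousOn
        (hq.differentiableOn.continuousOn.mono hbsub)).isClosed h1
      rintro _ ⟨x, hx, rfl⟩
      exact image_mono ball_subset_closedBall (hlt x (by simpa using hx))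
    obtain ⟨ζ, hζ, hζe⟩ := himg z₀ le_rfl
    have hζn : ‖ζ‖ = ρ := by
      refine le_antisymm (by simpa using hζ) (not_lt.mp fun h => hz₀U ⟨ζ, by simpa using h, hζe⟩)
    have hζd := hbsub hζ
    have hωζ : g (s z₀) = ζ := by rw [← hζe, hg ζ hζd]
    have hρc : (ρ : ℂ) ≠ 0 := by exact_mod_cast hρ0.ne'
    obtain ⟨m, hm, hmeq⟩ := exists_mul_deriv_eq_of_norm_eq_one (f := fun z => g (s z) / ρ) hz₀ne
      (fun z hz => (hωd z (hmem z hz) (image_mono hbsub (himg z hz))).div_const _)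
      (fun z hz => by
        obtain ⟨x, hx, hxe⟩ := himg z hz
        rw [← hxe, hg x (hbsub hx), norm_div, Complex.norm_real, Real.norm_of_nonneg hρ0.le,
          div_le_one hρ0]
        simpa using hx)
      (by rw [hωζ, norm_div, Complex.norm_real, Real.norm_of_nonneg hρ0.le, hζn, div_self hρ0.ne'])
    have hm1 : 1 ≤ m := by
      have : g (s 0) / ρ = 0 := by rw [hs0, hg 0 zero_mem_disk, zero_div]
      simpa [this] using hm
    have hder : HasDerivAt (fun z => g (s z) / ρ) ((deriv q ζ)⁻¹ * deriv s z₀ / ρ) z₀ := by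
      have h1 := hgd ζ hζd
      rw [hζe] at h1
      exact (h1.comp z₀ (hasDerivAt_of_differentiableOn hs hz₀)).div_const _
    rw [hder.deriv, hωζ] at hmeq
    have hq0 := hq.deriv_ne_zero ζ hζd
    have hsd : z₀ * deriv s z₀ = m * (ζ * deriv q ζ) := by
      field_simp at hmeq
      linear_combination hmeq
    have hray : h (w z₀) = h ζ + ((m - 1) / k : ℝ) * (ζ * deriv q ζ) := by
      rw [← hw z₀ hz₀, ← heq ζ hζd]
      simp only [← hζe, hsd]
      have : (k : ℂ) ≠ 0 := by exact_mod_cast hk.ne'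
      push_cast
      field_simp
      ring
    have hwz : ‖w z₀‖ < ‖ζ‖ := by
      rw [hζn]; exact (hwle z₀ hz₀).trans_lt (hz₀le.trans_lt hz₁)
    have := hq.eq_of_eq_add_mul hh hcc hζd hwz.le (div_nonneg (by linarith) hk.le) hray
    rw [this] at hwz
    exact lt_irrefl _ hwz
  have hall : ∀ z ∈ disk, s z ∈ q '' disk := by
    intro z hz
    obtain ⟨ρ, h1, h2⟩ := exists_between (mem_disk.mp hz)
    exact image_mono (ball_subset_ball h2.le) (hmain ρ h2 z h1)
  have hd : DifferentiableOn ℂ (fun z => g (s z)) disk := fun z hz =>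
    (hωd z hz (hall z hz)).differentiableWithinAt
  refine ⟨fun z => g (s z), hd, fun z hz => ?_, fun z hz => ?_⟩
  · refine Complex.norm_le_norm_of_mapsTo_ball hd (fun x hx => ?_)
      (by simp only [hs0, hg 0 zero_mem_disk]) (mem_disk.mp hz)
    obtain ⟨y, hy, hye⟩ := hall x hx
    simp only [← hye, hg y hy]
    exact ball_subset_closedBall hy
  · obtain ⟨y, hy, hye⟩ := hall z hz
    simp only [← hye, hg y hy]

/-- The Briot–Bouquet differential subordination `s + z s' / (κ + 1) ≺ h` for a function `h` whose
curvature functional exceeds `-γ_κ`. -/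
theorem isBestDominant_of_re_gt_neg_gammaBound {κ : ℝ} (hκ : -1 < κ) {h q : ℂ → ℂ}
    (hh : DifferentiableOn ℂ h disk) (hq : DifferentiableOn ℂ q disk)
    (heq : ∀ z ∈ disk, q z + z * deriv q z / ((κ : ℂ) + 1) = h z)
    (hh0 : ∀ z ∈ disk, deriv h z ≠ 0)
    (hre : ∀ z ∈ disk, -gammaBound κ < (z * deriv (deriv h) z / deriv h z + 1).re) :
    IsBestDominant (fun u v => u + v / ((κ : ℂ) + 1)) h q := by
  have hk : 0 < κ + 1 := by linarith
  have hδ := two_mul_gammaBound_le hκ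
  rw [show κ / (κ + 2) = (κ + 1 - 1) / (κ + 1 + 1) by ring_nf] at hδ
  have heq' : ∀ z ∈ disk, q z + z * deriv q z / ((κ + 1 : ℝ) : ℂ) = h z := by
    push_cast; exact heq
  have hall := fun z (hz : z ∈ disk) => re_one_add_mul_deriv_div_pos hk hq heq' hz
    (norm_two_mul_deriv_div_sub_one_lt hk hδ hh hq heq' hh0 hre hz)
  have hqc : LocallyConvex q := ⟨hq, fun z hz => (hall z hz).1, fun z hz => (hall z hz).2.1⟩
  have hcc : ∀ z ∈ disk, 0 < (deriv h z / deriv q z).re := fun z hz => (hall z hz).2.2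
  have hinj : InjOn h disk := by
    intro z hz ζ hζ he
    by_contra hne
    have := hqc.re_div_sub_pos hh hcc hz hζ hne
    simp [he] at this
  refine ⟨⟨⟨hh, hinj⟩, ⟨hq, hqc.injOn⟩, fun s hs => ?_⟩, fun q' hq' => ?_⟩
  · refine hqc.subordinate hk hh hcc heq' hs.1 ?_
    push_cast
    exact hs.2
  · exact hq'.2.2 q ⟨hq, id, differentiableOn_id, fun z _ => le_rfl, heq⟩

/-! ### Bessel-weighted power series -/

/-- The Pochhammer-weighted power series `∑ a_n (-c/4)^n / (κ)_n · z^n / n!`: for `a_n = 1` it is a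
normalized Bessel function, and for the shifted Taylor coefficients of `f` it is
`B_{κ,c}(f)(z) / z`. -/
noncomputable def besselSeries (a : ℕ → ℂ) (κ c z : ℂ) : ℂ :=
  ∑' n : ℕ, a n * ((-c / 4) ^ n / pochhammer κ n) * (z ^ n / (n.factorial : ℂ))

lemma pochhammer_zero (κ : ℂ) : pochhammer κ 0 = 1 := by simp [pochhammer]

lemma pochhammer_succ (κ : ℂ) (n : ℕ) : pochhammer κ (n + 1) = pochhammer κ n * (κ + n) :=
  ascPochhammer_succ_eval n κ

lemma pochhammer_succ_left (κ : ℂ) (n : ℕ) : pochhammer κ (n + 1) = κ * pochhammer (κ + 1) n := by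
  simp [pochhammer, ascPochhammer_succ_left]

lemma min_le_norm_pochhammer {k : ℝ} (hk : 0 < k) (n : ℕ) : min 1 k ≤ ‖pochhammer k n‖ := by
  rcases n with _ | n
  · simp [pochhammer_zero]
  refine (min_le_right _ _).trans ?_
  induction n with
  | zero => simp [pochhammer_succ, pochhammer_zero, abs_of_pos hk]
  | succ n ih =>
    have h1 : ‖(k : ℂ) + (n + 1 : ℕ)‖ = k + (n + 1 : ℕ) := by
      rw [← Complex.ofReal_natCast, ← Complex.ofReal_add, Complex.norm_real,
        Real.norm_of_nonneg (by positivity)]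
    rw [pochhammer_succ, norm_mul, h1]
    push_cast
    nlinarith [n.cast_nonneg (α := ℝ)]

lemma pochhammer_ne_zero {k : ℝ} (hk : 0 < k) (n : ℕ) : pochhammer k n ≠ 0 :=
  norm_pos_iff.mp ((lt_min one_pos hk).trans_le (min_le_norm_pochhammer hk n))

section Series

variable {a : ℕ → ℂ} {C R k : ℝ}

lemma summable_besselSeries_bound (C R k : ℝ) (c : ℂ) :
    Summable fun n : ℕ => C / min 1 k * ((R * (‖c‖ / 4)) ^ n / n.factorial) :=
  (Real.summable_pow_div_factorial _).mul_left _

lemma norm_besselSeries_term_le (ha : ∀ n, ‖a n‖ ≤ C * R ^ n) (hk : 0 < k) (c : ℂ) (n : ℕ)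
    {z : ℂ} (hz : z ∈ disk) :
    ‖a n * ((-c / 4) ^ n / pochhammer k n) * (z ^ n / (n.factorial : ℂ))‖ ≤
      C / min 1 k * ((R * (‖c‖ / 4)) ^ n / n.factorial) := by
  have hz1 : ‖z‖ ^ n ≤ 1 := pow_le_one₀ (norm_nonneg _) (mem_disk.mp hz).le
  have hm : 0 < min 1 k := lt_min one_pos hk
  have hC : 0 ≤ C * R ^ n := (norm_nonneg _).trans (ha n)
  rw [norm_mul, norm_mul, norm_div, norm_div, norm_pow, norm_div, norm_neg, norm_pow,
    Complex.norm_natCast, Complex.norm_ofNat]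
  calc ‖a n‖ * ((‖c‖ / 4) ^ n / ‖pochhammer k n‖) * (‖z‖ ^ n / n.factorial)
      ≤ C * R ^ n * ((‖c‖ / 4) ^ n / min 1 k) * (1 / n.factorial) := by
        gcongr
        · exact ha n
        · exact min_le_norm_pochhammer hk n
    _ = C / min 1 k * ((R * (‖c‖ / 4)) ^ n / n.factorial) := by
        rw [mul_pow]; field_simp

lemma hasSum_besselSeries (ha : ∀ n, ‖a n‖ ≤ C * R ^ n) (hk : 0 < k) (c : ℂ) {z : ℂ}
    (hz : z ∈ disk) :
    HasSum (fun n : ℕ => a n * ((-c / 4) ^ n / pochhammer k n) * (z ^ n / (n.factorial : ℂ)))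
      (besselSeries a k c z) :=
  (Summable.of_norm_bounded (summable_besselSeries_bound C R k c)
    fun n => norm_besselSeries_term_le ha hk c n hz).hasSum

lemma differentiableOn_besselSeries (ha : ∀ n, ‖a n‖ ≤ C * R ^ n) (hk : 0 < k) (c : ℂ) :
    DifferentiableOn ℂ (besselSeries a k c) disk :=
  differentiableOn_tsum_of_summable_norm (summable_besselSeries_bound C R k c)
    (fun n => by fun_prop) isOpen_disk fun n _ hz => norm_besselSeries_term_le ha hk c n hz

lemma hasSum_deriv_besselSeries (ha : ∀ n, ‖a n‖ ≤ C * R ^ n) (hk : 0 < k) (c : ℂ) {z : ℂ}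
    (hz : z ∈ disk) :
    HasSum (fun n : ℕ =>
      a n * ((-c / 4) ^ n / pochhammer k n) * (n * z ^ (n - 1) / (n.factorial : ℂ)))
      (deriv (besselSeries a k c) z) := by
  refine (hasSum_deriv_of_summable_norm (summable_besselSeries_bound C R k c)
    (F := fun n z => a n * ((-c / 4) ^ n / pochhammer k n) * (z ^ n / (n.factorial : ℂ)))
    (fun n => by fun_prop) isOpen_disk
    (fun n _ hz => norm_besselSeries_term_le ha hk c n hz) hz).congr_fun fun n => ?_
  simp

/-- The coefficients with parameters `k` and `k + 1` differ by the factor `1 + n / k`, which is the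
action of `s ↦ s + z s' / k` on `z ^ n`. -/
lemma besselSeries_add_mul_deriv (ha : ∀ n, ‖a n‖ ≤ C * R ^ n) (hk : 0 < k) (c : ℂ) {z : ℂ}
    (hz : z ∈ disk) :
    besselSeries a (k + 1) c z + z * deriv (besselSeries a (k + 1) c) z / k =
      besselSeries a k c z := by
  have hk1 : 0 < k + 1 := by linarith
  have hkc : (k : ℂ) ≠ 0 := by exact_mod_cast hk.ne'
  have h1 := hasSum_besselSeries ha hk1 c hz
  have h2 := hasSum_deriv_besselSeries ha hk1 c hz
  push_cast at h1 h2
  refine (h1.add ((h2.mul_left z).div_const (k : ℂ))).unique ?_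
  refine (hasSum_besselSeries ha hk c hz).congr_fun fun n => ?_
  have hp0 := pochhammer_ne_zero hk n
  have hkn : (k : ℂ) + n ≠ 0 := by exact_mod_cast (by positivity : k + n ≠ 0)
  have hp : pochhammer ((k : ℂ) + 1) n = pochhammer k n * (k + n) / k := by
    rw [← pochhammer_succ, pochhammer_succ_left, mul_div_cancel_left₀ _ hkc]
  have hz' : z * (n * z ^ (n - 1)) = n * z ^ n := by
    rcases n with _ | n
    · simp
    · rw [Nat.add_sub_cancel, pow_succ]; ring
  have hf : (n.factorial : ℂ) ≠ 0 := by exact_mod_cast n.factorial_ne_zero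
  rw [hp, mul_left_comm z, ← mul_div_assoc z, hz']
  field_simp

end Series

lemma besselU_eq_besselSeries (p b c : ℂ) :
    besselU p b c = besselSeries (fun _ => 1) (p + (b + 1) / 2) c := by
  ext z
  simp [besselU, besselSeries]

lemma besselSeries_zero (a : ℕ → ℂ) (κ c : ℂ) : besselSeries a κ c 0 = a 0 := by
  rw [besselSeries, tsum_eq_single 0 (fun n hn => by simp [hn])]
  simp [pochhammer_zero]

lemma besselBQuot_eq_besselSeries {f : ℂ → ℂ} (hf : ClassA f) (κ c : ℂ) :
    besselBQuot κ c f = besselSeries (fun n => taylorCoeff f (n + 1)) κ c := by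
  ext z
  by_cases hz : z = 0
  · rw [hz, besselSeries_zero, besselBQuot, if_pos rfl]
    simp [taylorCoeff, hf.2.2]
  · rw [besselBQuot, if_neg hz, besselB, besselSeries, ← tsum_div_const]
    congr 1
    ext n
    rw [pow_succ]
    field_simp

/-- Cauchy's estimate on the circle of radius `1 / 2`. -/
lemma exists_norm_taylorCoeff_le {f : ℂ → ℂ} (hf : DifferentiableOn ℂ f disk) :
    ∃ C : ℝ, ∀ n, ‖taylorCoeff f (n + 1)‖ ≤ C * 2 ^ n := by
  have hsub : closedBall (0 : ℂ) (1 / 2) ⊆ disk := closedBall_subset_ball (by norm_num)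
  obtain ⟨M, hM⟩ := (isCompact_closedBall (0 : ℂ) (1 / 2)).exists_bound_of_continuousOn
    (hf.continuousOn.mono hsub)
  refine ⟨2 * M, fun n => ?_⟩
  have h1 := Complex.norm_iteratedDeriv_le_of_forall_mem_sphere_norm_le (c := 0) (n + 1)
    (by norm_num : (0 : ℝ) < 1 / 2) (DifferentiableOn.diffContOnCl (f := f) (by
      rw [closure_ball _ (by norm_num)]; exact hf.mono hsub))
    (fun z hz => hM z (sphere_subset_closedBall hz))
  have h2 : (0 : ℝ) < (n + 1).factorial := by exact_mod_cast (n + 1).factorial_pos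
  rw [taylorCoeff, norm_div, Complex.norm_natCast, div_le_iff₀ h2]
  refine h1.trans_eq ?_
  rw [div_pow, one_pow, pow_succ]
  field_simp

/-! ### Affine dominants -/

lemma gammaBound_pos {κ : ℝ} (hκ : -1 < κ) : 0 < gammaBound κ := by
  have h1 : 0 < κ + 1 := by linarith
  refine div_pos (sub_pos.mpr ?_) (by positivity)
  rw [Real.sqrt_lt' (by positivity)]
  nlinarith [pow_pos h1 2]

section Linear

variable {κ : ℝ} {s S : ℂ → ℂ}

/-- For `h` affine and non-constant the best dominant is affine. -/
lemma subordinate_affine_of_ne_zero (hκ : -1 < κ) (hs : DifferentiableOn ℂ s disk)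
    (heq : ∀ z ∈ disk, s z + z * deriv s z / ((κ : ℂ) + 1) = S z) {β : ℂ} (hβ : β ≠ 0)
    (hS : Subordinate S fun z => 1 + β * z) :
    Subordinate s fun z => 1 + β * ((κ + 1) / (κ + 2)) * z := by
  have h1 : (κ : ℂ) + 1 ≠ 0 := by exact_mod_cast (by linarith : κ + 1 ≠ 0)
  have h2 : (κ : ℂ) + 2 ≠ 0 := by exact_mod_cast (by linarith : κ + 2 ≠ 0)
  have hd : ∀ (γ z : ℂ), HasDerivAt (fun z => 1 + γ * z) γ z := fun γ z => by
    simpa using ((hasDerivAt_id z).const_mul γ).const_add 1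
  have hderiv : ∀ γ : ℂ, deriv (fun z => 1 + γ * z) = fun _ => γ := fun γ =>
    funext fun z => (hd γ z).deriv
  have hbest := isBestDominant_of_re_gt_neg_gammaBound hκ (h := fun z => 1 + β * z)
    (q := fun z => 1 + β * ((κ + 1) / (κ + 2)) * z)
    (fun z _ => (hd _ z).differentiableAt.differentiableWithinAt)
    (fun z _ => (hd _ z).differentiableAt.differentiableWithinAt)
    (fun z _ => by simp only [hderiv]; field_simp; ring)
    (fun z _ => by simpa only [hderiv] using hβ)
    (fun z _ => by simp only [hderiv]; simp; linarith [gammaBound_pos hκ])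
  obtain ⟨w, hw, hwle, hwe⟩ := hS
  exact hbest.1.2.2 s ⟨hs, w, hw, hwle, fun z hz => (heq z hz).trans (hwe z hz)⟩

lemma subordinate_affine (hκ : -1 < κ) (hs : DifferentiableOn ℂ s disk)
    (heq : ∀ z ∈ disk, s z + z * deriv s z / ((κ : ℂ) + 1) = S z) {β : ℂ}
    (hS : Subordinate S fun z => 1 + β * z) :
    Subordinate s fun z => 1 + β * ((κ + 1) / (κ + 2)) * z := by
  rcases eq_or_ne β 0 with rfl | hβ
  swap
  · exact subordinate_affine_of_ne_zero hκ hs heq hβ hS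
  -- a constant `1` is subordinate to `1 + ε z` for every `ε`
  obtain ⟨v, -, -, hv⟩ := hS
  refine ⟨fun _ => 0, differentiableOn_const 0, fun z _ => by simp, fun z hz => ?_⟩
  have hle : ∀ ε : ℝ, 0 < ε → ‖s z - 1‖ ≤ ε * ‖((κ : ℂ) + 1) / (κ + 2)‖ := by
    intro ε hε
    obtain ⟨w, -, hwle, hw⟩ := subordinate_affine_of_ne_zero hκ hs heq (β := (ε : ℂ))
      (by exact_mod_cast hε.ne') ⟨fun _ => 0, differentiableOn_const 0, fun z _ => by simp,
        fun z hz => by simpa using hv z hz⟩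
    have h1 : ‖w z‖ ≤ 1 := (hwle z hz).trans (mem_disk.mp hz).le
    rw [hw z hz, add_sub_cancel_left, norm_mul, norm_mul, Complex.norm_real,
      Real.norm_of_nonneg hε.le]
    exact mul_le_of_le_one_right (by positivity) h1
  have h0 : ‖s z - 1‖ ≤ 0 := by
    refine le_of_forall_pos_le_add fun δ hδ => ?_
    have h2 : 0 < 1 + ‖((κ : ℂ) + 1) / (κ + 2)‖ := by positivity
    have h3 := hle (δ / (1 + ‖((κ : ℂ) + 1) / (κ + 2)‖)) (by positivity)
    refine h3.trans ?_
    rw [zero_add, div_mul_eq_mul_div, div_le_iff₀ h2]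
    nlinarith
  simpa [sub_eq_zero] using h0

/-- By the Schwarz lemma, `|S - 1| < M` is the subordination `S ≺ 1 + M z`. -/
lemma norm_sub_one_lt (hκ : -1 < κ) (hs : DifferentiableOn ℂ s disk) (hs0 : s 0 = 1)
    (heq : ∀ z ∈ disk, s z + z * deriv s z / ((κ : ℂ) + 1) = S z)
    (hSd : DifferentiableOn ℂ S disk) {M : ℝ} (hS : ∀ z ∈ disk, ‖S z - 1‖ < M)
    {z : ℂ} (hz : z ∈ disk) : ‖s z - 1‖ < M * ((κ + 1) / (κ + 2)) := by
  have hM : 0 < M := (norm_nonneg _).trans_lt (hS 0 zero_mem_disk)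
  have hMc : (M : ℂ) ≠ 0 := by exact_mod_cast hM.ne'
  have hS0 : S 0 = 1 := by simpa [hs0] using (heq 0 zero_mem_disk).symm
  have hd : DifferentiableOn ℂ (fun z => (S z - 1) / M) disk := (hSd.sub_const 1).div_const _
  obtain ⟨w, -, hwle, hw⟩ := subordinate_affine hκ hs heq (β := (M : ℂ))
    ⟨fun z => (S z - 1) / M, hd, fun z hz =>
      Complex.norm_le_norm_of_mapsTo_ball hd (fun x hx => by
        rw [mem_closedBall_zero_iff, norm_div, Complex.norm_real, Real.norm_of_nonneg hM.le,
          div_le_one hM]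
        exact (hS x hx).le) (by simp [hS0]) (mem_disk.mp hz), fun z _ => by field_simp; ring⟩
  have h1 : 0 < κ + 1 := by linarith
  have h2 : 0 < κ + 2 := by linarith
  have h3 : ‖(M : ℂ) * ((κ + 1) / (κ + 2))‖ = M * ((κ + 1) / (κ + 2)) := by
    rw [← Real.norm_of_nonneg (by positivity : 0 ≤ M * ((κ + 1) / (κ + 2))), ← Complex.norm_real]
    push_cast
    rfl
  rw [hw z hz, add_sub_cancel_left, norm_mul, h3]
  exact mul_lt_of_lt_one_right (by positivity) ((hwle z hz).trans_lt (mem_disk.mp hz))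

end Linear

lemma norm_one_le_one_mul_one_pow (n : ℕ) : ‖(1 : ℂ)‖ ≤ 1 * 1 ^ n := by simp

lemma besselSeries_one_norm_sub_one_lt {k : ℝ} (hk : 0 < k) (c : ℂ) {M : ℝ}
    (hM : ∀ z ∈ disk, ‖besselSeries (fun _ => 1) k c z - 1‖ < M) {z : ℂ} (hz : z ∈ disk) :
    ‖besselSeries (fun _ => 1) (k + 1) c z - 1‖ < M * (k / (k + 1)) := by
  have hd := differentiableOn_besselSeries norm_one_le_one_mul_one_pow
    (by linarith : 0 < k + 1) c
  push_cast at hd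
  have := norm_sub_one_lt (κ := k - 1) (M := M) (by linarith) hd (besselSeries_zero _ _ _)
    (fun z hz => by simpa using besselSeries_add_mul_deriv norm_one_le_one_mul_one_pow hk c hz)
    (differentiableOn_besselSeries norm_one_le_one_mul_one_pow hk c) hM hz
  convert this using 3 <;> ring

/-! ### The trigonometric cases -/

lemma csqrt_sq (z : ℂ) : csqrt z ^ 2 = z := by
  simp [csqrt]

lemma csqrt_ne_zero {z : ℂ} (hz : z ≠ 0) : csqrt z ≠ 0 := fun h => hz (by
  rw [← csqrt_sq z, h]; simp)

/-- `n! (1/2)_n 4ⁿ = (2n)!` -/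
lemma factorial_mul_pochhammer_half (n : ℕ) :
    (n.factorial : ℂ) * pochhammer (1 / 2) n * 4 ^ n = (2 * n).factorial := by
  induction n with
  | zero => simp [pochhammer_zero]
  | succ n ih =>
    rw [pochhammer_succ, Nat.factorial_succ, show 2 * (n + 1) = 2 * n + 1 + 1 by ring,
      Nat.factorial_succ, Nat.factorial_succ]
    push_cast
    rw [← ih]
    ring

lemma pochhammer_three_halves (n : ℕ) :
    pochhammer (3 / 2) n = pochhammer (1 / 2) n * (2 * n + 1) := by
  have h1 := pochhammer_succ_left (1 / 2) n
  rw [pochhammer_succ, show (1 / 2 + 1 : ℂ) = 3 / 2 by norm_num] at h1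
  linear_combination (-2) * h1

lemma pochhammer_five_halves (n : ℕ) :
    pochhammer (5 / 2) n = pochhammer (3 / 2) (n + 1) * (2 / 3) := by
  rw [pochhammer_succ_left, show (3 / 2 + 1 : ℂ) = 5 / 2 by norm_num]
  ring

lemma factorial_mul_pochhammer_three_halves (n : ℕ) :
    (n.factorial : ℂ) * pochhammer (3 / 2) n * 4 ^ n = (2 * n + 1).factorial := by
  rw [pochhammer_three_halves, Nat.factorial_succ]
  push_cast
  rw [← factorial_mul_pochhammer_half]
  ring

lemma pochhammer_half_ne_zero (n : ℕ) : pochhammer (1 / 2) n ≠ 0 := by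
  simpa using pochhammer_ne_zero (by norm_num : (0 : ℝ) < 1 / 2) n

lemma cos_csqrt (z : ℂ) : cos (csqrt z) = besselSeries (fun _ => 1) (1 / 2) 1 z := by
  rw [besselSeries, Complex.cos_eq_tsum]
  congr 1
  ext n
  rw [pow_mul, csqrt_sq, ← factorial_mul_pochhammer_half, div_pow]
  have := pochhammer_half_ne_zero n
  have hf : (n.factorial : ℂ) ≠ 0 := by exact_mod_cast n.factorial_ne_zero
  field_simp

lemma sin_csqrt_div {z : ℂ} (hz : z ≠ 0) :
    sin (csqrt z) / csqrt z = besselSeries (fun _ => 1) (3 / 2) 1 z := by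
  rw [besselSeries, Complex.sin_eq_tsum, ← tsum_div_const]
  congr 1
  ext n
  have h0 := csqrt_ne_zero hz
  have h1 := pochhammer_half_ne_zero n
  have h2 : (2 * n + 1 : ℂ) ≠ 0 := by exact_mod_cast (by positivity : 2 * n + 1 ≠ 0)
  have hf : (n.factorial : ℂ) ≠ 0 := by exact_mod_cast n.factorial_ne_zero
  rw [pow_succ, pow_mul, csqrt_sq, ← factorial_mul_pochhammer_three_halves, div_pow,
    pochhammer_three_halves]
  field_simp

/-- The contiguous relation `z u_{5/2} = 3 (u_{3/2} - u_{1/2})`, by comparing coefficients. -/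
lemma three_mul_sin_csqrt_sub {z : ℂ} (hzd : z ∈ disk) (hz : z ≠ 0) :
    3 * (sin (csqrt z) / (z * csqrt z)) - 3 * (cos (csqrt z) / z) =
      besselSeries (fun _ => 1) (5 / 2) 1 z := by
  have h1 := hasSum_besselSeries norm_one_le_one_mul_one_pow (by norm_num : (0 : ℝ) < 1 / 2) 1 hzd
  have h3 := hasSum_besselSeries norm_one_le_one_mul_one_pow (by norm_num : (0 : ℝ) < 3 / 2) 1 hzd
  have h5 := hasSum_besselSeries norm_one_le_one_mul_one_pow (by norm_num : (0 : ℝ) < 5 / 2) 1 hzd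
  push_cast at h1 h3 h5
  have h31 := (hasSum_nat_add_iff' 1).mpr (h3.sub h1)
  have h6 := h31.unique ((h5.mul_right (z / 3)).congr_fun fun n => ?_)
  · rw [Finset.sum_range_one] at h6
    simp only [pochhammer_zero, sub_self, sub_zero] at h6
    rw [← cos_csqrt, ← sin_csqrt_div hz] at h6
    have h0 := csqrt_ne_zero hz
    field_simp at h6 ⊢
    linear_combination h6
  · have hp := pochhammer_half_ne_zero (n + 1)
    have hf : (n.factorial : ℂ) ≠ 0 := by exact_mod_cast n.factorial_ne_zero
    have hn : (n + 1 : ℂ) ≠ 0 := by exact_mod_cast n.succ_ne_zero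
    have hn3 : (2 * (n + 1) + 1 : ℂ) ≠ 0 := by exact_mod_cast (by positivity : 2 * (n + 1) + 1 ≠ 0)
    rw [pochhammer_five_halves, pochhammer_three_halves, Nat.factorial_succ]
    push_cast
    field_simp
    ring

end BesselSubordination

/-! ### The subordination theorem for the operators `B_{κ,c}` -/

theorem mainTheorem5 (p b κ : ℝ) (c : ℂ) (hκ : κ = p + (b + 1) / 2) (hκ' : -1 < κ) (hc : c ≠ 0) :
    -- the corollary
    (∀ g Ψ : ℂ → ℂ, ClassA g → Ψ = besselBQuot (κ + 1) c g →
      (∀ z ∈ disk, deriv Ψ z ≠ 0) →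
      (∀ z ∈ disk, -gammaBound κ < (z * deriv (deriv Ψ) z / deriv Ψ z + 1).re) →
      (∀ f : ℂ → ℂ, ClassA f →
        Subordinate (besselBQuot (κ + 1) c f) Ψ →
        Subordinate (besselBQuot (κ + 2) c f) (besselBQuot (κ + 2) c g)) ∧
      IsBestDominant (fun u v => u + v / (κ + 1)) Ψ (besselBQuot (κ + 2) c g)) ∧
    -- the case `f(z) = z / (1 - z)`, `g(z) = z + a z²`, in both of its forms
    (∀ a : ℂ, ‖a‖ < 1 / 2 →
      (Subordinate (besselU (p + 1) b c) (fun z => 1 - a * c * z / (4 * (κ + 1))) →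
        Subordinate (besselU (p + 2) b c) (fun z => 1 - a * c * z / (4 * (κ + 2)))) ∧
      ((∀ z ∈ disk, ‖besselU (p + 1) b c z - 1‖ < ‖a * c / (4 * (κ + 1))‖) →
        ∀ z ∈ disk, ‖besselU (p + 2) b c z - 1‖ < ‖a * c / (4 * (κ + 2))‖)) ∧
    -- the trigonometric chain
    (∀ a : ℂ, ‖a‖ < 1 / 2 →
      ((∀ z ∈ disk, ‖cos (csqrt z) - 1‖ < ‖a‖ / 2) →
        ∀ z ∈ disk, z ≠ 0 → ‖sin (csqrt z) / csqrt z - 1‖ < ‖a‖ / 6) ∧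
      ((∀ z ∈ disk, z ≠ 0 → ‖sin (csqrt z) / csqrt z - 1‖ < ‖a‖ / 6) →
        ∀ z ∈ disk, z ≠ 0 →
          ‖3 * (sin (csqrt z) / (z * csqrt z)) - 3 * (cos (csqrt z) / z) - 1‖ < ‖a‖ / 10)) := by
  have hk1 : 0 < κ + 1 := by linarith
  have hk2 : 0 < κ + 1 + 1 := by linarith
  have e2 : (κ : ℂ) + 2 = ((κ + 1 : ℝ) : ℂ) + 1 := by push_cast; ring
  have hrel : ∀ {f : ℂ → ℂ}, ClassA f → DifferentiableOn ℂ (besselBQuot (κ + 1) c f) disk ∧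
      DifferentiableOn ℂ (besselBQuot (κ + 2) c f) disk ∧
      ∀ z ∈ disk, besselBQuot (κ + 2) c f z + z * deriv (besselBQuot (κ + 2) c f) z / (κ + 1) =
        besselBQuot (κ + 1) c f z := by
    intro f hf
    obtain ⟨C, hC⟩ := exists_norm_taylorCoeff_le hf.1.1
    rw [besselBQuot_eq_besselSeries hf, besselBQuot_eq_besselSeries hf, e2]
    have h1 := differentiableOn_besselSeries hC hk1 c
    have h2 := differentiableOn_besselSeries hC hk2 c
    have h3 := fun z (hz : z ∈ disk) => besselSeries_add_mul_deriv hC hk1 c hz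
    push_cast at h1 h2 h3 ⊢
    exact ⟨h1, h2, h3⟩
  have hu1 : besselU (p + 1) b c = besselSeries (fun _ => 1) ((κ + 1 : ℝ) : ℂ) c := by
    rw [besselU_eq_besselSeries, hκ]; congr 1; push_cast; ring
  have hu2 : besselU (p + 2) b c = besselSeries (fun _ => 1) (((κ + 1 : ℝ) : ℂ) + 1) c := by
    rw [besselU_eq_besselSeries, hκ]; congr 1; push_cast; ring
  have hc1 : (κ : ℂ) + 1 ≠ 0 := by exact_mod_cast hk1.ne'
  have hc2 : (κ : ℂ) + 2 ≠ 0 := by rw [e2]; exact_mod_cast hk2.ne'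
  refine ⟨fun g Ψ hg hΨ hΨ0 hre => ?_, fun a _ => ⟨fun hsub => ?_, fun hM z hz => ?_⟩,
    fun a _ => ⟨fun hM z hz hz0 => ?_, fun hM z hz hz0 => ?_⟩⟩
  · subst hΨ
    obtain ⟨hΨd, hqd, heq⟩ := hrel hg
    have hbest := isBestDominant_of_re_gt_neg_gammaBound hκ' hΨd hqd heq hΨ0 hre
    refine ⟨fun f hf hsub => ?_, hbest⟩
    obtain ⟨-, hsd, hseq⟩ := hrel hf
    obtain ⟨w, hw, hwle, hwe⟩ := hsub
    exact hbest.1.2.2 _ ⟨hsd, w, hw, hwle, fun z hz => (hseq z hz).trans (hwe z hz)⟩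
  · have hd := differentiableOn_besselSeries norm_one_le_one_mul_one_pow hk2 c
    have heq := fun z (hz : z ∈ disk) =>
      besselSeries_add_mul_deriv norm_one_le_one_mul_one_pow hk1 c hz
    rw [Complex.ofReal_add, Complex.ofReal_one, ← hu2] at hd
    rw [← hu1, ← hu2] at heq
    push_cast at heq
    have h := subordinate_affine hκ' hd heq (β := -(a * c) / (4 * (κ + 1))) (by
      convert hsub using 2 with z; ring)
    convert h using 2 with z
    field_simp
    ring
  · rw [hu1] at hM
    rw [hu2]
    have h := besselSeries_one_norm_sub_one_lt hk1 c hM hz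
    convert h using 1
    have h1 : ‖(κ : ℂ) + 1‖ = κ + 1 := by
      rw [← Real.norm_of_nonneg hk1.le, ← Complex.norm_real]; push_cast; rfl
    have h2 : ‖(κ : ℂ) + 2‖ = κ + 1 + 1 := by
      rw [e2, ← Real.norm_of_nonneg hk2.le, ← Complex.norm_real]; push_cast; rfl
    rw [norm_div, norm_div, norm_mul 4, norm_mul 4, h1, h2]
    field_simp
  · have h := besselSeries_one_norm_sub_one_lt (by norm_num : (0 : ℝ) < 1 / 2) 1 (M := ‖a‖ / 2)
      (fun z hz => by simpa [cos_csqrt] using hM z hz) hz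
    rw [sin_csqrt_div hz0]
    convert h using 1
    · congr 3; push_cast; norm_num
    · ring
  · have ha : 0 < ‖a‖ / 6 := (norm_nonneg _).trans_lt (hM z hz hz0)
    have h := besselSeries_one_norm_sub_one_lt (by norm_num : (0 : ℝ) < 3 / 2) 1 (M := ‖a‖ / 6)
      (fun z hz => by
        rcases eq_or_ne z 0 with rfl | hz0
        · simpa [besselSeries_zero] using ha
        · simpa [← sin_csqrt_div hz0] using hM z hz hz0) hz
    rw [three_mul_sin_csqrt_sub hz hz0]
    convert h using 1
    · congr 3; push_cast; norm_num
    · ring
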